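/- Let $\Gamma\subset\mathrm{SL}(2,\mathbb R)$ be a discrete subgroup with $-1\in\Gamma$ such that $\Gamma\backslash\mathbb H$ has finite hyperbolic area and has a cusp of width one at infinity, i.e. $\begin{pmatrix}1&x\\0&1\end{pmatrix}\in\Gamma$ if and only if $x\in\mathbb Z$. Let $\mathcal F_\Gamma\subset\mathbb H$ be a fundamental domain for the action of $\Gamma$ on $\mathbb H$ by Möbius transformations, and let $\operatorname{vol}_{\mathbb H}$ be the measure $dx\,dy/y^2$. Write $$n(s)=\begin{pmatrix}1&s\\0&1\end{pmatrix},\qquad a(t)=\begin{pmatrix}e^{t/2}&0\\0&e^{-t/2}\end{pmatrix}.$$ On $\mathcal X=\Gamma\backslash\mathrm{SL}(2,\mathbb R)$ consider the geodesic flow $\varphi_t(x)=x\,a(t)$, the unstable horocycle flow $h^+_r(x)=x\begin{pmatrix}1&0\\-r&1\end{pmatrix}$ and the stable horocycle flow $h^-_s(x)=x\,n(s)$. Let $\mathcal C=\{h^-_s(\Gamma 1):s\in\mathbb R\}$, a closed stable horocycle of length one, and let $\mathcal H(0)=\bigcup_{t\ge 0}\varphi_t(\mathcal C)$, a section which is parametrised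 by $\Sigma=[0,1)\times[0,\infty)$ through $\iota_0(s,t)=\varphi_t(h^-_s(\Gamma 1))=\Gamma\, n(s)a(t)$. For $w\in\Sigma$ let $$\eta_1(w)=\inf\{r>0: h^+_r(\iota_0(w))\in\mathcal H(0)\},\qquad \eta_{-1}(w)=\inf\{r>0: h^+_{-r}(\iota_0(w))\in\mathcal H(0)\}$$ be the first forward and backward return times, with values in $[0,\infty]$. Let $d\nu(s,t)=e^{-t}\,dt\,ds$ on $\Sigma$, let $\overline\eta_1=\int_\Sigma\eta_1\,d\nu\in[0,\infty]$ be the mean return time, and for $r>0$, $w\in\Sigma$ let $$\Psi(r,w)=\frac1{\overline\eta_1}\,\mathbb 1\big(r<\eta_{-1}(w)\big)$$ be the limit density (of the rescaled first hitting time and its impact parameter). Finally let $\mathcal P_\Gamma=(0,1)\Gamma\subset\mathbb R^2$ and, for $r>0$, $\Delta_{-r}=\{u\in\mathbb R^2: -r u_2\le u_1<0,\ 0<u_2\le 1\}$. Then for all $r>0$ and $(s,t)\in\Sigma$, $$\Psi(r,s,t)=\frac1{\overline\eta_1}\,\mathbb 1\big(\mathcal P_\Gamma\, n(s)\,a(t)\cap\Delta_{-r}=\emptyset\big).$$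 Moreover $\eta_1$ is Borel measurable, and $$\overline\eta_1=\pi\operatorname{vol}_{\mathbb H}(\mathcal F_\Gamma)<\infty .$$ -/

import Mathlib

open MeasureTheory
open scoped MatrixGroups ENNReal

namespace Horocycle

noncomputable section

/-- The diagonal matrix `a(t) = diag (e^{t/2}, e^{-t/2})`. -/
def aMat (t : ℝ) : SL(2, ℝ) :=
  ⟨!![Real.exp (t / 2), 0; 0, Real.exp (-t / 2)], by
    rw [Matrix.det_fin_two_of, ← Real.exp_add, neg_div, add_neg_cancel, Real.exp_zero]
    ring⟩

/-- The upper triangular unipotent matrix `n(s) = (1 s; 0 1)`. -/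
def nMat (s : ℝ) : SL(2, ℝ) :=
  ⟨!![1, s; 0, 1], by simp [Matrix.det_fin_two_of]⟩

/-- The lower triangular unipotent matrix `(1 0; r 1)`. -/
def lowMat (r : ℝ) : SL(2, ℝ) :=
  ⟨!![1, 0; r, 1], by simp [Matrix.det_fin_two_of]⟩

/-- The unit tangent bundle `𝒳 = Γ \ SL(2,ℝ)` of `𝒴 = Γ \ ℍ`: the space of cosets `Γ g`. -/
def UnitTangentBundle (Γ : Subgroup SL(2, ℝ)) : Type :=
  Quotient (QuotientGroup.rightRel Γ)

/-- The point `Γ g` of `𝒳`. -/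
def toX (Γ : Subgroup SL(2, ℝ)) (g : SL(2, ℝ)) : UnitTangentBundle Γ :=
  Quotient.mk (QuotientGroup.rightRel Γ) g

/-- Right multiplication `Γ g ↦ Γ g h` on `𝒳`. -/
def rightMul (Γ : Subgroup SL(2, ℝ)) (h : SL(2, ℝ)) :
    UnitTangentBundle Γ → UnitTangentBundle Γ :=
  Quotient.map (fun g => g * h) (by
    intro a b hab
    have hab' : QuotientGroup.rightRel Γ a b := hab
    change QuotientGroup.rightRel Γ (a * h) (b * h)
    rw [QuotientGroup.rightRel_apply] at hab' ⊢
    simpa [mul_assoc] using hab')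

/-- The geodesic flow `φ_t (Γ g) = Γ g a(t)`. -/
def geodesicFlow (Γ : Subgroup SL(2, ℝ)) (t : ℝ) : UnitTangentBundle Γ → UnitTangentBundle Γ :=
  rightMul Γ (aMat t)

/-- The unstable horocycle flow `h⁺_s (Γ g) = Γ g (1 0; -s 1)`. -/
def unstableFlow (Γ : Subgroup SL(2, ℝ)) (s : ℝ) : UnitTangentBundle Γ → UnitTangentBundle Γ :=
  rightMul Γ (lowMat (-s))

/-- The stable horocycle flow `h⁻_s (Γ g) = Γ g (1 s; 0 1)`. -/
def stableFlow (Γ : Subgroup SL(2, ℝ)) (s : ℝ) : UnitTangentBundle Γ → UnitTangentBundle Γ :=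
  rightMul Γ (nMat s)

/-- `Γ` has a cusp of width one at infinity: the elements `(1 x; 0 1)` of `Γ` are exactly those
with `x ∈ ℤ`. -/
def HasWidthOneCuspAtInfinity (Γ : Subgroup SL(2, ℝ)) : Prop :=
  ∀ x : ℝ, nMat x ∈ Γ ↔ ∃ m : ℤ, x = m

/-- The stable horocycle `𝒞 = {h⁻_s (Γ 1) : s ∈ ℝ}` around the cusp at infinity; it is closed of
length one if that cusp has width one. -/
def closedHorocycle (Γ : Subgroup SL(2, ℝ)) : Set (UnitTangentBundle Γ) :=
  Set.range fun s : ℝ => stableFlow Γ s (toX Γ 1)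

/-- The Poincaré section `ℋ(R) = {φ_t (𝒞) : t ≥ R}`. -/
def section' (Γ : Subgroup SL(2, ℝ)) (R : ℝ) : Set (UnitTangentBundle Γ) :=
  {x | ∃ t : ℝ, R ≤ t ∧ ∃ c ∈ closedHorocycle Γ, x = geodesicFlow Γ t c}

/-- The parameter space `Σ = [0,1) × [0,∞)`. -/
def paramSpace : Set (ℝ × ℝ) := Set.Ico 0 1 ×ˢ Set.Ici 0

/-- The parametrisation `ι_R (s,t) = φ_{t+R} (h⁻_s (Γ 1))` of `ℋ(R)`, for `(s,t) ∈ Σ`. -/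
def embed (Γ : Subgroup SL(2, ℝ)) (R : ℝ) (w : ℝ × ℝ) : UnitTangentBundle Γ :=
  geodesicFlow Γ (w.2 + R) (stableFlow Γ w.1 (toX Γ 1))

/-- The first return time `η₁(w) ∈ [0,∞]` of `ι_0(w)` to `ℋ(0)` under the unstable horocycle flow:
the infimum of the `r > 0` with `h⁺_r (ι_0 w) ∈ ℋ(0)` (and `∞` if there are none). -/
def returnTime (Γ : Subgroup SL(2, ℝ)) (w : ℝ × ℝ) : ℝ≥0∞ :=
  sInf {a | ∃ r : ℝ, 0 < r ∧ unstableFlow Γ r (embed Γ 0 w) ∈ section' Γ 0 ∧ a = ENNReal.ofReal r}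

/-- The first backwards return time `η₋₁(w) ∈ [0,∞]` to `ℋ(0)`. -/
def backReturnTime (Γ : Subgroup SL(2, ℝ)) (w : ℝ × ℝ) : ℝ≥0∞ :=
  sInf {a | ∃ r : ℝ, 0 < r ∧ unstableFlow Γ (-r) (embed Γ 0 w) ∈ section' Γ 0 ∧
    a = ENNReal.ofReal r}

/-- The measure `dν(s,t) = e^{-t} dt ds` on `Σ`, as a measure on `ℝ × ℝ` carried by `Σ`. -/
def nu : Measure (ℝ × ℝ) :=
  (volume.restrict paramSpace).withDensity fun w => ENNReal.ofReal (Real.exp (-w.2))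

/-- The mean return time `η̄₁ = ∫_Σ η₁ dν ∈ [0,∞]`. -/
def meanReturnTime (Γ : Subgroup SL(2, ℝ)) : ℝ≥0∞ :=
  ∫⁻ w, returnTime Γ w ∂nu

open Classical in
/-- The indicator `𝟙(p)` of a proposition: `1` if `p` holds and `0` otherwise. -/
def ind (p : Prop) : ℝ := if p then 1 else 0

/-- The limit density `Ψ(r,w) = (1/η̄₁) 𝟙(r < η₋₁(w))`. -/
def limitDensity (Γ : Subgroup SL(2, ℝ)) (r : ℝ) (w : ℝ × ℝ) : ℝ :=
  1 / (meanReturnTime Γ).toReal * ind (ENNReal.ofReal r < backReturnTime Γ w)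

/-- The set `𝒫_Γ g = (0,1) Γ g` of row vectors. -/
def pointSet (Γ : Subgroup SL(2, ℝ)) (g : SL(2, ℝ)) : Set (Fin 2 → ℝ) :=
  {u | ∃ γ ∈ Γ, u = Matrix.vecMul ![0, 1] (γ * g : SL(2, ℝ)).val}

/-- The triangle `Δ_{-X} = {u : -X u₂ ≤ u₁ < 0, 0 < u₂ ≤ 1}`. -/
def negTriangle (X : ℝ) : Set (Fin 2 → ℝ) :=
  {u | -X * u 1 ≤ u 0 ∧ u 0 < 0 ∧ 0 < u 1 ∧ u 1 ≤ 1}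

/-- The group of Möbius transformations of `ℍ` induced by `Γ` (that is, the image of `Γ` in
`PSL(2,ℝ)`; the element `-1` acts trivially). -/
def moebiusGroup (Γ : Subgroup SL(2, ℝ)) : Subgroup (Equiv.Perm UpperHalfPlane) :=
  Γ.map (MulAction.toPermHom SL(2, ℝ) UpperHalfPlane)

end

end Horocycle

/-!
In the coordinates `g = n(s) a(t) (1 0; -r 1)` on `SL(2, ℝ)` the measure `e^{-t} ds dt dr` is a
Haar measure. The points with `(s, t) ∈ Σ` and `0 ≤ r < η₁(s, t)` form the suspension of the
section under the first return time, so the Haar measure of the suspension is `η̄₁`; it meets every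
`Γ`-orbit that has hit the section in the past exactly once. Letting the horocycle flow run for
time `n` and then applying `φ_{2n}` maps the set of `g` with a past hit into itself, and every orbit
eventually gets there. Since this map preserves the Haar measure and commutes with `Γ`, the set of
`g` with a past hit is conull modulo `Γ` as soon as it has finite covolume. Hence `η̄₁` is the Haar
covolume of `Γ`, and pushing the Haar measure forward along `g ↦ g i` yields a Cauchy density on
each fibre, whose integral is the factor `π`.
-/

namespace Horocycle

noncomputable section

section Matrices

lemma isCompact_setOf_norm_entry_le {n R : Type*} [Fintype n] [DecidableEq n] [NormedCommRing R]
    [ProperSpace R] (C : ℝ) :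
    IsCompact {k : Matrix.SpecialLinearGroup n R | ∀ i j, ‖k i j‖ ≤ C} := by
  have hclosed : Topology.IsClosedEmbedding
      (Subtype.val : Matrix.SpecialLinearGroup n R → Matrix n n R) :=
    .subtypeVal <| isClosed_eq (Continuous.matrix_det continuous_id) continuous_const
  have hbox : IsCompact {A : Matrix n n R | ∀ i j, A i j ∈ Metric.closedBall 0 C} :=
    isCompact_pi_infinite fun _ => isCompact_pi_infinite fun _ => isCompact_closedBall 0 C
  simp only [mem_closedBall_zero_iff] at hbox
  exact hclosed.isCompact_preimage hbox

lemma finite_setOf_mem_and_norm_conj_entry_le {n R : Type*} [Fintype n] [DecidableEq n]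
    [NormedCommRing R] [ProperSpace R] (Γ : Subgroup (Matrix.SpecialLinearGroup n R))
    [DiscreteTopology Γ] (g : Matrix.SpecialLinearGroup n R) (C : ℝ) :
    {γ | γ ∈ Γ ∧ ∀ i j, ‖(g⁻¹ * γ * g) i j‖ ≤ C}.Finite := by
  have hcompact : IsCompact {γ | ∀ i j, ‖(g⁻¹ * γ * g) i j‖ ≤ C} :=
    ((Homeomorph.mulLeft g⁻¹).trans (Homeomorph.mulRight g)).isCompact_preimage.2
      (isCompact_setOf_norm_entry_le C)
  have hclosed : IsClosed (Γ : Set (Matrix.SpecialLinearGroup n R)) := Subgroup.isClosed_of_discrete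
  exact (hcompact.inter_left hclosed).finite
    (IsDiscrete.mono (s := (Γ : Set _)) ⟨‹_›⟩ Set.inter_subset_left)

lemma det_eq_one (g : SL(2, ℝ)) : g 0 0 * g 1 1 - g 0 1 * g 1 0 = 1 := by
  rw [← Matrix.det_fin_two, g.det_coe]

lemma coe_aMat (t : ℝ) : (aMat t).val = !![Real.exp (t / 2), 0; 0, Real.exp (-t / 2)] := rfl

lemma coe_nMat (s : ℝ) : (nMat s).val = !![1, s; 0, 1] := rfl

lemma coe_lowMat (r : ℝ) : (lowMat r).val = !![1, 0; r, 1] := rfl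

lemma nMat_add (s s' : ℝ) : nMat (s + s') = nMat s * nMat s' := by
  apply Subtype.ext
  simp [coe_nMat, add_comm]

lemma nMat_zero : nMat 0 = 1 := by
  apply Subtype.ext
  simp [coe_nMat, Matrix.one_fin_two]

lemma lowMat_add (r r' : ℝ) : lowMat (r + r') = lowMat r * lowMat r' := by
  apply Subtype.ext
  simp [coe_lowMat]

lemma lowMat_zero : lowMat 0 = 1 := by
  apply Subtype.ext
  simp [coe_lowMat, Matrix.one_fin_two]

lemma mul_lowMat_apply_one_zero (g : SL(2, ℝ)) (r : ℝ) :
    (g * lowMat r) 1 0 = g 1 0 + r * g 1 1 := by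
  simp [coe_lowMat, Matrix.mul_apply, Fin.sum_univ_two, mul_comm]

lemma mul_lowMat_apply_one_one (g : SL(2, ℝ)) (r : ℝ) : (g * lowMat r) 1 1 = g 1 1 := by
  simp [coe_lowMat, Matrix.mul_apply, Fin.sum_univ_two]

lemma mul_aMat_apply_one_zero (g : SL(2, ℝ)) (t : ℝ) :
    (g * aMat t) 1 0 = Real.exp (t / 2) * g 1 0 := by
  simp [coe_aMat, Matrix.mul_apply, Fin.sum_univ_two, mul_comm]

lemma mul_aMat_apply_one_one (g : SL(2, ℝ)) (t : ℝ) :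
    (g * aMat t) 1 1 = Real.exp (-t / 2) * g 1 1 := by
  simp [coe_aMat, Matrix.mul_apply, Fin.sum_univ_two, mul_comm]

/-- The element `n(s) a(t) (1 0; -r 1)`, that is, the point reached from `n(s) a(t)` after time `r`
of the unstable horocycle flow. These are the coordinates on the elements with positive lower right
entry in which the section is `{r = 0}`. -/
def horoChart (s t r : ℝ) : SL(2, ℝ) := nMat s * aMat t * lowMat (-r)

lemma exp_half_eq_inv (t : ℝ) : Real.exp (t / 2) = (Real.exp (-t / 2))⁻¹ := by
  rw [← Real.exp_neg, neg_div, neg_neg]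

lemma coe_horoChart (s t r : ℝ) : (horoChart s t r).val =
    !![(Real.exp (-t / 2))⁻¹ - r * (s * Real.exp (-t / 2)), s * Real.exp (-t / 2);
      -r * Real.exp (-t / 2), Real.exp (-t / 2)] := by
  rw [horoChart, Matrix.SpecialLinearGroup.coe_mul, Matrix.SpecialLinearGroup.coe_mul, coe_nMat,
    coe_aMat, coe_lowMat, exp_half_eq_inv]
  ext i j
  fin_cases i <;> fin_cases j <;> simp [mul_comm r, sub_eq_add_neg]

lemma horoChart_zero (s t : ℝ) : horoChart s t 0 = nMat s * aMat t := by
  rw [horoChart, neg_zero, lowMat_zero, mul_one]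

/-- The coordinate `s` of `g = horoChart s t r`. -/
def coordS (g : SL(2, ℝ)) : ℝ := g 0 1 / g 1 1

/-- The coordinate `t` of `g = horoChart s t r`. -/
def coordT (g : SL(2, ℝ)) : ℝ := -2 * Real.log (g 1 1)

/-- The coordinate `r` of `g = horoChart s t r`. -/
def coordR (g : SL(2, ℝ)) : ℝ := -g 1 0 / g 1 1

lemma horoChart_coord {g : SL(2, ℝ)} (hg : 0 < g 1 1) :
    horoChart (coordS g) (coordT g) (coordR g) = g := by
  have hexp : Real.exp (-coordT g / 2) = g 1 1 := by
    rw [coordT, show -(-2 * Real.log (g 1 1)) / 2 = Real.log (g 1 1) by ring, Real.exp_log hg]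
  have hdet := det_eq_one g
  ext i j
  rw [coe_horoChart, hexp, coordS, coordR]
  fin_cases i <;> fin_cases j <;> simp <;> field_simp
  linarith

lemma coordS_horoChart (s t r : ℝ) : coordS (horoChart s t r) = s := by
  simp [coordS, coe_horoChart]

lemma coordT_horoChart (s t r : ℝ) : coordT (horoChart s t r) = t := by
  simp only [coordT, coe_horoChart, Matrix.of_apply, Matrix.cons_val', Matrix.cons_val_one,
    Matrix.cons_val_fin_one, Real.log_exp]
  ring

lemma coordR_horoChart (s t r : ℝ) : coordR (horoChart s t r) = r := by
  simp [coordR, coe_horoChart]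

lemma coordT_nonneg_iff {g : SL(2, ℝ)} (hg : 0 < g 1 1) : 0 ≤ coordT g ↔ g 1 1 ≤ 1 := by
  rw [coordT, neg_mul, neg_nonneg, ← Real.log_nonpos_iff hg.le]
  constructor <;> intro h <;> linarith

end Matrices

section HitTimes

variable {Γ : Subgroup SL(2, ℝ)}

lemma toX_eq_iff {g h : SL(2, ℝ)} : toX Γ g = toX Γ h ↔ ∃ γ ∈ Γ, γ * g = h := by
  refine (Quotient.eq (r := QuotientGroup.rightRel Γ)).trans ?_
  rw [QuotientGroup.rightRel_apply]
  constructor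
  · exact fun hmem => ⟨_, hmem, inv_mul_cancel_right h g⟩
  · rintro ⟨γ, hγ, rfl⟩
    rwa [mul_inv_cancel_right]

lemma toX_mem_section_iff_exists_nMat_mul_aMat {g : SL(2, ℝ)} :
    toX Γ g ∈ section' Γ 0 ↔ ∃ t : ℝ, 0 ≤ t ∧ ∃ s : ℝ, ∃ γ ∈ Γ, γ * g = nMat s * aMat t := by
  have hflow (s t : ℝ) :
      geodesicFlow Γ t (stableFlow Γ s (toX Γ 1)) = toX Γ (nMat s * aMat t) :=
    congrArg (fun n => toX Γ (n * aMat t)) (one_mul (nMat s))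
  simp only [section', closedHorocycle, Set.mem_ofPred_eq, Set.exists_range_iff, hflow, toX_eq_iff]

lemma toX_mem_section_iff {g : SL(2, ℝ)} : toX Γ g ∈ section' Γ 0 ↔
    ∃ γ ∈ Γ, (γ * g) 1 0 = 0 ∧ 0 < (γ * g) 1 1 ∧ (γ * g) 1 1 ≤ 1 := by
  rw [toX_mem_section_iff_exists_nMat_mul_aMat]
  constructor
  · rintro ⟨t, ht, s, γ, hγ, h⟩
    refine ⟨γ, hγ, ?_⟩
    rw [h, ← horoChart_zero, coe_horoChart]
    simpa [Real.exp_pos, neg_div] using div_nonneg ht zero_le_two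
  · rintro ⟨γ, hγ, h0, hpos, hle⟩
    refine ⟨_, (coordT_nonneg_iff hpos).2 hle, coordS (γ * g), γ, hγ, ?_⟩
    have hR : coordR (γ * g) = 0 := by rw [coordR, h0, neg_zero, zero_div]
    rw [← horoChart_zero, ← hR, horoChart_coord hpos]

/-- The times at which the unstable horocycle orbit of `Γ g` meets the section `ℋ(0)`. -/
def hitTimes (Γ : Subgroup SL(2, ℝ)) (g : SL(2, ℝ)) : Set ℝ :=
  {r | unstableFlow Γ r (toX Γ g) ∈ section' Γ 0}

lemma mem_hitTimes_iff_toX {g : SL(2, ℝ)} {r : ℝ} :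
    r ∈ hitTimes Γ g ↔ toX Γ (g * lowMat (-r)) ∈ section' Γ 0 := Iff.rfl

lemma mem_hitTimes {g : SL(2, ℝ)} {r : ℝ} : r ∈ hitTimes Γ g ↔
    ∃ γ ∈ Γ, (γ * g) 1 0 = r * (γ * g) 1 1 ∧ 0 < (γ * g) 1 1 ∧ (γ * g) 1 1 ≤ 1 := by
  simp only [mem_hitTimes_iff_toX, toX_mem_section_iff, ← mul_assoc, mul_lowMat_apply_one_zero,
    mul_lowMat_apply_one_one, neg_mul, add_neg_eq_zero]

lemma div_mem_hitTimes {g γ : SL(2, ℝ)} (hγ : γ ∈ Γ) (hpos : 0 < (γ * g) 1 1)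
    (hle : (γ * g) 1 1 ≤ 1) : (γ * g) 1 0 / (γ * g) 1 1 ∈ hitTimes Γ g :=
  mem_hitTimes.2 ⟨γ, hγ, (div_mul_cancel₀ _ hpos.ne').symm, hpos, hle⟩

lemma mem_hitTimes_mul_lowMat_neg {g : SL(2, ℝ)} {r r' : ℝ} :
    r ∈ hitTimes Γ (g * lowMat (-r')) ↔ r' + r ∈ hitTimes Γ g := by
  rw [mem_hitTimes_iff_toX, mem_hitTimes_iff_toX, mul_assoc, ← lowMat_add, neg_add]

lemma hitTimes_mul_left {γ : SL(2, ℝ)} (hγ : γ ∈ Γ) (g : SL(2, ℝ)) :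
    hitTimes Γ (γ * g) = hitTimes Γ g :=
  congrArg (fun x => {r | unstableFlow Γ r x ∈ section' Γ 0})
    (toX_eq_iff.2 ⟨γ, hγ, rfl⟩ : toX Γ g = toX Γ (γ * g)).symm

lemma coe_inv_mul_nMat_mul (h : SL(2, ℝ)) (x : ℝ) : (h⁻¹ * nMat x * h).val =
    !![1 + x * (h 1 0 * h 1 1), x * h 1 1 ^ 2; -(x * h 1 0 ^ 2), 1 - x * (h 1 0 * h 1 1)] := by
  have hdet := det_eq_one h
  ext i j
  rw [Matrix.SpecialLinearGroup.coe_mul, Matrix.SpecialLinearGroup.coe_mul,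
    Matrix.SpecialLinearGroup.coe_inv, Matrix.adjugate_fin_two, coe_nMat, Matrix.mul_fin_two,
    Matrix.eta_fin_two h.val, Matrix.mul_fin_two]
  fin_cases i <;> fin_cases j <;>
    simp only [Fin.zero_eta, Fin.mk_one, Matrix.of_apply, Matrix.cons_val', Matrix.cons_val_zero,
      Matrix.cons_val_one, Matrix.cons_val_fin_one]
  · linear_combination hdet
  · ring
  · ring
  · linear_combination hdet

lemma abs_coe_inv_mul_nMat_one_mul_apply_le {h : SL(2, ℝ)} {r R : ℝ} (h10 : h 1 0 = r * h 1 1)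
    (hr : |r| ≤ R) (h11 : |h 1 1| ≤ 1) (i j : Fin 2) :
    |(h⁻¹ * nMat 1 * h) i j| ≤ 1 + R + R ^ 2 := by
  have hsq : h 1 1 ^ 2 ≤ 1 := (sq_le_one_iff_abs_le_one _).2 h11
  have hrsq : r ^ 2 ≤ R ^ 2 := sq_le_sq' (abs_le.1 hr).1 (abs_le.1 hr).2
  have hprod : |r * h 1 1 ^ 2| ≤ R := by
    rw [abs_mul, abs_of_nonneg (sq_nonneg (h 1 1))]
    exact (mul_le_of_le_one_right (abs_nonneg r) hsq).trans hr
  obtain ⟨hlower, hupper⟩ := abs_le.1 hprod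
  rw [coe_inv_mul_nMat_mul, h10, abs_le]
  fin_cases i <;> fin_cases j <;> simp <;> constructor <;> nlinarith [sq_nonneg r]

/- The orbit hits the section at time `r` when some `h ∈ Γ g` has second row `(r d, d)` with
`0 < d ≤ 1`. The unipotent `h⁻¹ n(1) h` of the discrete group `g⁻¹ Γ g` determines `r` and has
entries bounded in terms of `r` alone. -/
lemma finite_hitTimes_inter_Icc [DiscreteTopology Γ] (hΓ : nMat 1 ∈ Γ) (g : SL(2, ℝ)) (R : ℝ) :
    (hitTimes Γ g ∩ Set.Icc (-R) R).Finite := by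
  refine ((finite_setOf_mem_and_norm_conj_entry_le Γ g (1 + R + R ^ 2)).image
    fun γ => ((g⁻¹ * γ * g) 0 0 - 1) / (g⁻¹ * γ * g) 0 1).subset ?_
  rintro r ⟨hr, hrR⟩
  obtain ⟨γ, hγ, h10, hpos, hle⟩ := mem_hitTimes.1 hr
  have hconj : g⁻¹ * (γ⁻¹ * nMat 1 * γ) * g = (γ * g)⁻¹ * nMat 1 * (γ * g) := by group
  refine ⟨γ⁻¹ * nMat 1 * γ, ⟨Γ.mul_mem (Γ.mul_mem (Γ.inv_mem hγ) hΓ) hγ, fun i j => ?_⟩, ?_⟩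
  · rw [hconj]
    exact abs_coe_inv_mul_nMat_one_mul_apply_le h10 (abs_le.2 hrR) (by rwa [abs_of_pos hpos]) i j
  · simp only [hconj, coe_inv_mul_nMat_mul, h10]
    simp only [one_mul, Matrix.of_apply, Matrix.cons_val', Matrix.cons_val_zero,
      Matrix.cons_val_one, Matrix.cons_val_fin_one, add_sub_cancel_left]
    field_simp

lemma vecMul_zero_one (g : SL(2, ℝ)) : Matrix.vecMul ![0, 1] g.val = g.val 1 := by
  ext j
  simp [Matrix.vecMul, dotProduct, Fin.sum_univ_two]

lemma mem_hitTimes_iff_exists_mem_pointSet {g : SL(2, ℝ)} {r : ℝ} :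
    r ∈ hitTimes Γ g ↔ ∃ u ∈ pointSet Γ g, u 0 = r * u 1 ∧ 0 < u 1 ∧ u 1 ≤ 1 := by
  simp only [mem_hitTimes, pointSet, vecMul_zero_one, Set.mem_ofPred_eq]
  constructor
  · rintro ⟨γ, hγ, h⟩
    exact ⟨_, ⟨γ, hγ, rfl⟩, h⟩
  · rintro ⟨_, ⟨γ, hγ, rfl⟩, h⟩
    exact ⟨γ, hγ, h⟩

lemma pointSet_inter_negTriangle_eq_empty_iff {g : SL(2, ℝ)} {X : ℝ} :
    pointSet Γ g ∩ negTriangle X = ∅ ↔ ∀ r ∈ hitTimes Γ g, r < 0 → r < -X := by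
  simp only [Set.eq_empty_iff_forall_notMem, mem_hitTimes_iff_exists_mem_pointSet]
  constructor
  · rintro h r ⟨u, hu, hu0, hpos, hle⟩ hr
    by_contra! hX
    refine h u ⟨hu, ?_, ?_, hpos, hle⟩
    · rw [hu0]
      exact mul_le_mul_of_nonneg_right hX hpos.le
    · rw [hu0]
      exact mul_neg_of_neg_of_pos hr hpos
  · rintro h u ⟨hu, hX, hneg, hpos, hle⟩
    have hlt : u 0 / u 1 < -X := h _ ⟨u, hu, (div_mul_cancel₀ _ hpos.ne').symm, hpos, hle⟩
      (div_neg_of_neg_of_pos hneg hpos)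
    exact ((div_lt_iff₀ hpos).1 hlt).not_ge hX

end HitTimes

section ReturnTime

/-- The infimum of the positive elements of `S`, as an element of `[0, ∞]`; it is `∞` if there are
none. -/
def firstPositive (S : Set ℝ) : ℝ≥0∞ := ⨅ r ∈ S ∩ Set.Ioi 0, ENNReal.ofReal r

lemma exists_gt_forall_le_of_finite_inter_Ioc {S : Set ℝ} {r : ℝ} {R : ℝ} (hR : r < R)
    (hS : (S ∩ Set.Ioc r R).Finite) : ∃ b > r, ∀ r' ∈ S, r < r' → b ≤ r' := by
  obtain ⟨b, hb, hmin⟩ := Set.exists_min_image _ id (hS.insert R) ⟨R, Set.mem_insert _ _⟩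
  refine ⟨b, ?_, fun r' hr' hlt => ?_⟩
  · rcases hb with rfl | hb
    exacts [hR, hb.2.1]
  · rcases le_total r' R with hle | hle
    · exact hmin r' (.inr ⟨hr', hlt, hle⟩)
    · exact (hmin R (.inl rfl)).trans hle

lemma sInf_setOf_pos_eq_firstPositive (S : Set ℝ) :
    sInf {a | ∃ r : ℝ, 0 < r ∧ r ∈ S ∧ a = ENNReal.ofReal r} = firstPositive S := by
  rw [firstPositive, ← sInf_image]
  congr 1
  ext a
  constructor
  · rintro ⟨r, hr, hrS, rfl⟩
    exact ⟨r, ⟨hrS, hr⟩, rfl⟩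
  · rintro ⟨r, ⟨hrS, hr⟩, rfl⟩
    exact ⟨r, hr, hrS, rfl⟩

lemma lt_firstPositive_iff {S : Set ℝ} (hS : ∀ R, (S ∩ Set.Icc (-R) R).Finite) {r : ℝ}
    (hr : 0 ≤ r) : ENNReal.ofReal r < firstPositive S ↔ ∀ r' ∈ S, 0 < r' → r < r' := by
  constructor
  · intro h r' hr' hpos
    exact (ENNReal.ofReal_lt_ofReal_iff hpos).1 (h.trans_le (iInf₂_le r' ⟨hr', hpos⟩))
  · intro h
    obtain ⟨b, hb, hmin⟩ := exists_gt_forall_le_of_finite_inter_Ioc (lt_add_one r) <|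
      (hS (r + 1)).subset <| Set.inter_subset_inter_right S <|
        Set.Ioc_subset_Icc_self.trans (Set.Icc_subset_Icc_left (by linarith))
    refine ((ENNReal.ofReal_lt_ofReal_iff (hr.trans_lt hb)).2 hb).trans_le (le_iInf₂ ?_)
    exact fun r' hr' => ENNReal.ofReal_le_ofReal (hmin r' hr'.1 (h r' hr'.1 hr'.2))

lemma volume_setOf_nonneg_and_ofReal_lt (a : ℝ≥0∞) :
    volume {r : ℝ | 0 ≤ r ∧ ENNReal.ofReal r < a} = a := by
  induction a with
  | top =>
    have hset : {r : ℝ | 0 ≤ r ∧ ENNReal.ofReal r < ⊤} = Set.Ici 0 := by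
      ext r
      simp only [ENNReal.ofReal_lt_top, and_true, Set.mem_ofPred_eq, Set.mem_Ici]
    rw [hset, Real.volume_Ici]
  | coe a =>
    have hset : {r : ℝ | 0 ≤ r ∧ ENNReal.ofReal r < a} = Set.Ico 0 (a : ℝ) := by
      ext r
      refine and_congr_right fun hr => ?_
      rw [ENNReal.ofReal_lt_iff_lt_toReal hr ENNReal.coe_ne_top, ENNReal.coe_toReal]
    rw [hset, Real.volume_Ico, sub_zero, ENNReal.ofReal_coe_nnreal]

variable {Γ : Subgroup SL(2, ℝ)}

lemma embed_zero (w : ℝ × ℝ) : embed Γ 0 w = toX Γ (nMat w.1 * aMat w.2) := by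
  change toX Γ (1 * nMat w.1 * aMat (w.2 + 0)) = _
  rw [one_mul, add_zero]

lemma returnTime_eq_firstPositive (w : ℝ × ℝ) :
    returnTime Γ w = firstPositive (hitTimes Γ (nMat w.1 * aMat w.2)) := by
  rw [returnTime, embed_zero]
  exact sInf_setOf_pos_eq_firstPositive _

lemma backReturnTime_eq_firstPositive (w : ℝ × ℝ) :
    backReturnTime Γ w = firstPositive (Neg.neg ⁻¹' hitTimes Γ (nMat w.1 * aMat w.2)) := by
  rw [backReturnTime, embed_zero]
  exact sInf_setOf_pos_eq_firstPositive _

lemma lt_returnTime_iff [DiscreteTopology Γ] (hΓ : nMat 1 ∈ Γ) {r : ℝ} {w : ℝ × ℝ}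
    (hr : 0 ≤ r) : ENNReal.ofReal r < returnTime Γ w ↔
      ∀ r' ∈ hitTimes Γ (nMat w.1 * aMat w.2), 0 < r' → r < r' := by
  rw [returnTime_eq_firstPositive, lt_firstPositive_iff (finite_hitTimes_inter_Icc hΓ _) hr]

lemma lt_backReturnTime_iff [DiscreteTopology Γ] (hΓ : nMat 1 ∈ Γ) {r : ℝ} {w : ℝ × ℝ}
    (hr : 0 ≤ r) : ENNReal.ofReal r < backReturnTime Γ w ↔
      pointSet Γ (nMat w.1 * aMat w.2) ∩ negTriangle r = ∅ := by
  have hfinite (R : ℝ) :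
      (Neg.neg ⁻¹' hitTimes Γ (nMat w.1 * aMat w.2) ∩ Set.Icc (-R) R).Finite := by
    have := (finite_hitTimes_inter_Icc hΓ (nMat w.1 * aMat w.2) R).preimage neg_injective.injOn
    rwa [Set.preimage_inter, Set.neg_preimage, Set.neg_preimage, Set.neg_Icc, neg_neg] at this
  rw [backReturnTime_eq_firstPositive, lt_firstPositive_iff hfinite hr,
    pointSet_inter_negTriangle_eq_empty_iff, neg_surjective.forall]
  simp only [Set.mem_preimage, neg_neg, neg_pos, lt_neg]

end ReturnTime

section Measurability

variable {n R : Type*} [Fintype n] [DecidableEq n] [CommRing R]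

instance [TopologicalSpace R] [SecondCountableTopology R] :
    SecondCountableTopology (Matrix.SpecialLinearGroup n R) :=
  have : SecondCountableTopology (Matrix n n R) :=
    inferInstanceAs (SecondCountableTopology (n → n → R))
  TopologicalSpace.Subtype.secondCountableTopology _

lemma countable_of_discreteTopology {G : Type*} [Group G] [TopologicalSpace G]
    [SecondCountableTopology G] (Γ : Subgroup G) [DiscreteTopology Γ] : Countable Γ :=
  TopologicalSpace.separableSpace_iff_countable.1 inferInstance

variable [MeasurableSpace R]

instance : MeasurableSpace (Matrix.SpecialLinearGroup n R) :=
  inferInstanceAs (MeasurableSpace {A : n → n → R // Matrix.det A = 1})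

instance [TopologicalSpace R] [SecondCountableTopology R] [BorelSpace R] :
    BorelSpace (Matrix.SpecialLinearGroup n R) :=
  inferInstanceAs (BorelSpace {A : n → n → R // Matrix.det A = 1})

@[fun_prop]
lemma measurable_entry (i j : n) : Measurable fun g : Matrix.SpecialLinearGroup n R => g i j :=
  (measurable_pi_apply j).comp ((measurable_pi_apply i).comp measurable_subtype_coe)

lemma measurable_specialLinearGroup_iff {α : Type*} [MeasurableSpace α]
    {f : α → Matrix.SpecialLinearGroup n R} :
    Measurable f ↔ ∀ i j, Measurable fun x => f x i j := by
  refine measurable_comap_iff.trans ?_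
  simp only [measurable_pi_iff]
  rfl

end Measurability

section Haar

/-- The element of `SL(2, ℝ)` with second column `(b, d)` and second row `(-r d, d)`, if `d ≠ 0`.
If `d = 0` the column `(b, -1)` is used instead, so that the lower right entry is positive exactly
if `d` is. -/
def colChart (p : (ℝ × ℝ) × ℝ) : SL(2, ℝ) :=
  ⟨!![(if p.1.2 = 0 then -1 else p.1.2)⁻¹ - p.2 * p.1.1, p.1.1;
      -p.2 * (if p.1.2 = 0 then -1 else p.1.2), if p.1.2 = 0 then -1 else p.1.2], by
    have hne : (if p.1.2 = 0 then -1 else p.1.2) ≠ 0 := by split_ifs with h <;> simp [h]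
    rw [Matrix.det_fin_two_of]
    field_simp
    ring⟩

lemma coe_colChart {p : (ℝ × ℝ) × ℝ} (hp : p.1.2 ≠ 0) :
    (colChart p).val = !![p.1.2⁻¹ - p.2 * p.1.1, p.1.1; -p.2 * p.1.2, p.1.2] := by
  simp [colChart, hp]

lemma colChart_apply_one_one_pos {p : (ℝ × ℝ) × ℝ} : 0 < colChart p 1 1 ↔ 0 < p.1.2 := by
  change 0 < (if p.1.2 = 0 then -1 else p.1.2) ↔ _
  split_ifs with h <;> simp [h]

lemma measurable_colChart : Measurable colChart := by
  have hd : Measurable fun p : (ℝ × ℝ) × ℝ => if p.1.2 = 0 then (-1 : ℝ) else p.1.2 :=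
    Measurable.ite (measurableSet_eq_fun (by fun_prop) (by fun_prop)) (by fun_prop) (by fun_prop)
  rw [measurable_specialLinearGroup_iff]
  intro i j
  fin_cases i <;> fin_cases j
  exacts [hd.inv.sub (by fun_prop), measurable_fst.fst, measurable_snd.neg.mul hd, hd]

lemma colChart_eq_horoChart (s t r : ℝ) :
    colChart ((s * Real.exp (-t / 2), Real.exp (-t / 2)), r) = horoChart s t r :=
  Subtype.ext <| by rw [coe_colChart (Real.exp_pos _).ne', coe_horoChart]

@[fun_prop]
lemma measurable_horoChart {α : Type*} [MeasurableSpace α] {s t r : α → ℝ} (hs : Measurable s)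
    (ht : Measurable t) (hr : Measurable r) : Measurable fun x => horoChart (s x) (t x) (r x) := by
  simp only [← colChart_eq_horoChart]
  exact measurable_colChart.comp (by fun_prop)

/-- The Haar measure on `SL(2, ℝ)` that is `e^{-t} ds dt dr` in the coordinates
`g = horoChart s t r`. -/
def haarSL : Measure SL(2, ℝ) := (2 : ℝ≥0∞) • Measure.map colChart volume

lemma ae_snd_ne_zero : ∀ᵐ v : ℝ × ℝ, v.2 ≠ 0 :=
  (Measure.quasiMeasurePreserving_snd (μ := (volume : Measure ℝ)) (ν := (volume : Measure ℝ))).ae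
    (Measure.ae_ne volume 0)

lemma ae_fst_of_ae {p : ℝ × ℝ → Prop} (hp : ∀ᵐ v, p v) : ∀ᵐ q : (ℝ × ℝ) × ℝ, p q.1 :=
  (Measure.quasiMeasurePreserving_fst (μ := (volume : Measure (ℝ × ℝ)))
    (ν := (volume : Measure ℝ))).ae hp

lemma ae_haarSL_apply_one_one_ne_zero : ∀ᵐ g ∂haarSL, g 1 1 ≠ 0 := by
  refine Measure.ae_smul_measure ((ae_map_iff measurable_colChart.aemeasurable
    (measurableSet_eq_fun (measurable_entry 1 1) measurable_const).compl).2 ?_) 2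
  filter_upwards [ae_fst_of_ae ae_snd_ne_zero] with p hp
  change colChart p 1 1 ≠ 0
  rw [coe_colChart hp]
  exact hp

lemma measurePreserving_haarSL_of_colChart {f : SL(2, ℝ) → SL(2, ℝ)} (hf : Measurable f)
    {T : (ℝ × ℝ) × ℝ → (ℝ × ℝ) × ℝ} (hT : MeasurePreserving T)
    (h : ∀ᵐ p, f (colChart p) = colChart (T p)) : MeasurePreserving f haarSL haarSL := by
  refine ⟨hf, ?_⟩
  rw [haarSL, Measure.map_smul, Measure.map_map hf measurable_colChart,
    Measure.map_congr (f := f ∘ colChart) (g := colChart ∘ T) h,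
    ← Measure.map_map measurable_colChart hT.measurable, hT.map_eq]

lemma measurePreserving_shear {α : Type*} [MeasureSpace α] [SFinite (volume : Measure α)]
    {T : α → α} (hT : MeasurePreserving T) {c : α → ℝ} (hc : Measurable c) :
    MeasurePreserving fun p : α × ℝ => (T p.1, c p.1 + p.2) :=
  MeasurePreserving.skew_product (g := fun v r => c v + r) hT
    ((hc.comp measurable_fst).add measurable_snd)
    (Filter.Eventually.of_forall fun v => map_add_left_eq_self volume (c v))

lemma measurePreserving_mulVec_prod (h : SL(2, ℝ)) : MeasurePreserving
    fun v : ℝ × ℝ => (h 0 0 * v.1 + h 0 1 * v.2, h 1 0 * v.1 + h 1 1 * v.2) := by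
  set L := Matrix.toLin (Module.Basis.finTwoProd ℝ) (Module.Basis.finTwoProd ℝ) h.val with hL
  have hdet : LinearMap.det L = 1 := (LinearMap.det_toLin _ _).trans h.2
  have hmap := Measure.map_linearMap_addHaar_eq_smul_addHaar (volume : Measure (ℝ × ℝ))
    (hdet ▸ one_ne_zero : LinearMap.det L ≠ 0)
  have hcoe : ⇑L = fun v => (h 0 0 * v.1 + h 0 1 * v.2, h 1 0 * v.1 + h 1 1 * v.2) := by
    ext v <;> simp [hL, Matrix.toLin_apply, Matrix.mulVec, dotProduct, Fin.sum_univ_two]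
  rw [hdet, inv_one, abs_one, ENNReal.ofReal_one, one_smul, hcoe] at hmap
  exact ⟨by fun_prop, hmap⟩

/- Multiplication by `h` on the left acts on the second column linearly, with determinant `1`, and
translates the coordinate `r` by an amount that depends on the second column only. -/
lemma measurePreserving_mul_left_haarSL (h : SL(2, ℝ)) :
    MeasurePreserving (h * ·) haarSL haarSL := by
  have hcol := measurePreserving_mulVec_prod h
  refine measurePreserving_haarSL_of_colChart (measurable_const_mul h) (measurePreserving_shear hcol
    (c := fun v => -(h 1 0 / (v.2 * (h 1 0 * v.1 + h 1 1 * v.2)))) (by fun_prop)) ?_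
  filter_upwards [ae_fst_of_ae ae_snd_ne_zero,
    ae_fst_of_ae (hcol.quasiMeasurePreserving.ae ae_snd_ne_zero)] with ⟨⟨b, d⟩, r⟩ hd hD
  have hdet := det_eq_one h
  dsimp only at hd hD ⊢
  generalize hDdef : h 1 0 * b + h 1 1 * d = D at hD ⊢
  apply Subtype.ext
  rw [Matrix.SpecialLinearGroup.coe_mul, coe_colChart (by exact hd), coe_colChart (by exact hD),
    Matrix.eta_fin_two h.val, Matrix.mul_fin_two]
  ext i j
  fin_cases i <;> fin_cases j <;> simp <;> field_simp
  · linear_combination d * hdet - h 0 0 * hDdef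
  · linear_combination -(r * d) * hDdef
  · exact hDdef

instance : haarSL.IsMulLeftInvariant :=
  ⟨fun h => (measurePreserving_mul_left_haarSL h).map_eq⟩

lemma measurePreserving_mul_lowMat (τ : ℝ) : MeasurePreserving (· * lowMat τ) haarSL haarSL := by
  refine measurePreserving_haarSL_of_colChart (measurable_mul_const _)
    (measurePreserving_shear (.id _) (c := fun _ => -τ) measurable_const) ?_
  filter_upwards [ae_fst_of_ae ae_snd_ne_zero] with p hp
  apply Subtype.ext
  rw [Matrix.SpecialLinearGroup.coe_mul, coe_colChart hp, coe_colChart (by exact hp),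
    coe_lowMat, Matrix.mul_fin_two]
  ext i j
  fin_cases i <;> fin_cases j <;> simp <;> ring

lemma measurePreserving_smul_prod_sq_inv_mul {c : ℝ} (hc : 0 < c) :
    MeasurePreserving fun p : (ℝ × ℝ) × ℝ => (c • p.1, (c ^ 2)⁻¹ * p.2) := by
  have hsq : 0 < (c ^ 2)⁻¹ := by positivity
  have hfst := Measure.map_addHaar_smul (volume : Measure (ℝ × ℝ)) hc.ne'
  have hsnd := Real.map_volume_mul_left hsq.ne'
  rw [Module.finrank_prod, Module.finrank_self, one_add_one_eq_two, abs_of_pos hsq] at hfst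
  rw [inv_inv, abs_of_pos (by positivity)] at hsnd
  refine ⟨by fun_prop, ?_⟩
  change Measure.map (Prod.map (c • ·) ((c ^ 2)⁻¹ * ·)) (volume.prod volume) = _
  rw [← Measure.map_prod_map _ _ (by fun_prop) (by fun_prop), hfst, hsnd, Measure.prod_smul_left,
    Measure.prod_smul_right, smul_smul, ← ENNReal.ofReal_mul hsq.le,
    inv_mul_cancel₀ (by positivity), ENNReal.ofReal_one, one_smul]
  rfl

lemma measurePreserving_mul_aMat (t : ℝ) : MeasurePreserving (· * aMat t) haarSL haarSL := by
  refine measurePreserving_haarSL_of_colChart (measurable_mul_const _)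
    (measurePreserving_smul_prod_sq_inv_mul (Real.exp_pos (-t / 2))) ?_
  filter_upwards [ae_fst_of_ae ae_snd_ne_zero] with p hp
  have hpos := Real.exp_pos (-t / 2)
  apply Subtype.ext
  rw [Matrix.SpecialLinearGroup.coe_mul, coe_colChart hp, coe_colChart (by simpa using hp),
    coe_aMat, exp_half_eq_inv, Matrix.mul_fin_two]
  ext i j
  fin_cases i <;> fin_cases j <;> simp <;> field_simp

lemma lintegral_Ioi_zero_eq_lintegral_exp (f : ℝ → ℝ≥0∞) {k : ℝ} (hk : 0 < k) :
    ∫⁻ x in Set.Ioi 0, f x =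
      ∫⁻ t, ENNReal.ofReal (Real.exp (-t / k) / k) * f (Real.exp (-t / k)) := by
  have himg : (fun t : ℝ => Real.exp (-t / k)) '' Set.univ = Set.Ioi 0 := by
    have hsurj : Function.Surjective fun t : ℝ => -t / k :=
      fun x => ⟨-(k * x), by field_simp⟩
    rw [Set.image_univ, ← Real.range_exp, ← hsurj.range_comp Real.exp]
    rfl
  have hderiv (t : ℝ) (_ : t ∈ Set.univ) : HasDerivWithinAt (fun t : ℝ => Real.exp (-t / k))
      (Real.exp (-t / k) * (-1 / k)) Set.univ t :=
    ((hasDerivAt_id t).neg.div_const k).exp.hasDerivWithinAt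
  have hinj : Set.InjOn (fun t : ℝ => Real.exp (-t / k)) Set.univ := fun a _ b _ hab =>
    neg_injective ((div_left_inj' hk.ne').1 (Real.exp_injective hab))
  rw [← himg, lintegral_image_eq_lintegral_abs_deriv_mul MeasurableSet.univ hderiv hinj,
    Measure.restrict_univ]
  simp only [abs_mul, abs_div, abs_neg, abs_one, Real.abs_exp, abs_of_pos hk, mul_one_div]

lemma lintegral_eq_ofReal_mul_lintegral_comp_mul {f : ℝ → ℝ≥0∞} (hf : Measurable f) {c : ℝ}
    (hc : 0 < c) : ∫⁻ x, f x = ENNReal.ofReal c * ∫⁻ s, f (s * c) := by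
  conv_lhs => rw [← Real.smul_map_volume_mul_right hc.ne']
  rw [lintegral_smul_measure, lintegral_map hf (by fun_prop), abs_of_pos hc, smul_eq_mul]

lemma setLIntegral_snd_pos {f : ℝ × ℝ → ℝ≥0∞} (hf : Measurable f) {k : ℝ} (hk : 0 < k) :
    ∫⁻ v in {v | 0 < v.2}, f v = ∫⁻ w : ℝ × ℝ, ENNReal.ofReal (Real.exp (-(2 * w.2 / k)) / k) *
      f (w.1 * Real.exp (-w.2 / k), Real.exp (-w.2 / k)) := by
  have hset : {v : ℝ × ℝ | 0 < v.2} = Set.univ ×ˢ Set.Ioi 0 := by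
    ext v
    simp only [Set.mem_ofPred_eq, Set.mem_prod, Set.mem_univ, true_and, Set.mem_Ioi]
  rw [hset, Measure.volume_eq_prod, ← Measure.prod_restrict, Measure.restrict_univ,
    lintegral_prod_symm _ hf.aemeasurable, lintegral_prod_symm _ (by fun_prop),
    lintegral_Ioi_zero_eq_lintegral_exp _ hk]
  refine lintegral_congr fun t => ?_
  have hpos := Real.exp_pos (-t / k)
  have hexp : Real.exp (-(2 * t / k)) = Real.exp (-t / k) * Real.exp (-t / k) := by
    rw [← Real.exp_add]
    ring_nf
  dsimp only
  rw [lintegral_const_mul' _ _ ENNReal.ofReal_ne_top,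
    lintegral_eq_ofReal_mul_lintegral_comp_mul (by fun_prop) hpos, ← mul_assoc,
    ← ENNReal.ofReal_mul (by positivity), hexp, mul_div_right_comm]

lemma setLIntegral_haarSL {f : SL(2, ℝ) → ℝ≥0∞} (hf : Measurable f) :
    ∫⁻ g in {g | 0 < g 1 1}, f g ∂haarSL =
      ∫⁻ w : ℝ × ℝ, ENNReal.ofReal (Real.exp (-w.2)) * ∫⁻ r, f (horoChart w.1 w.2 r) := by
  have hpre : colChart ⁻¹' {g | 0 < g 1 1} = {v : ℝ × ℝ | 0 < v.2} ×ˢ Set.univ := by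
    ext p
    simp only [Set.mem_preimage, Set.mem_ofPred_eq, colChart_apply_one_one_pos, Set.mem_prod,
      Set.mem_univ, and_true]
  have hfc : Measurable fun p => f (colChart p) := hf.comp measurable_colChart
  rw [haarSL, Measure.restrict_smul, Measure.restrict_map measurable_colChart
    (measurableSet_lt measurable_const (measurable_entry 1 1)), lintegral_smul_measure,
    lintegral_map hf measurable_colChart, hpre, Measure.volume_eq_prod, ← Measure.prod_restrict,
    Measure.restrict_univ, lintegral_prod _ hfc.aemeasurable,
    setLIntegral_snd_pos hfc.lintegral_prod_right' two_pos, smul_eq_mul,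
    ← lintegral_const_mul' _ _ ENNReal.ofNat_ne_top]
  refine lintegral_congr fun w => ?_
  rw [← mul_assoc, ← ENNReal.ofReal_ofNat, ← ENNReal.ofReal_mul zero_le_two,
    mul_div_cancel₀ _ two_ne_zero, mul_div_cancel_left₀ _ two_ne_zero]
  simp only [colChart_eq_horoChart]

end Haar

section HalfPlane

/-- The point `e^{-t} (r + i)` of the upper half-plane, for `p = (r, t)`. In these coordinates the
invariant measure is `dr dt`. -/
def halfPlaneChart (p : ℝ × ℝ) : UpperHalfPlane :=
  ⟨⟨p.1 * Real.exp (-p.2), Real.exp (-p.2)⟩, Real.exp_pos _⟩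

lemma setLIntegral_im_pos {f : ℂ → ℝ≥0∞} (hf : Measurable f) : ∫⁻ z in {z | 0 < z.im}, f z =
    ∫⁻ w : ℝ × ℝ, ENNReal.ofReal (Real.exp (-(2 * w.2))) * f (halfPlaneChart w) := by
  have hcoe (w : ℝ × ℝ) : Complex.measurableEquivRealProd.symm
      (w.1 * Real.exp (-w.2), Real.exp (-w.2)) = halfPlaneChart w := rfl
  have hsubst := setLIntegral_snd_pos
    (hf.comp Complex.measurableEquivRealProd.symm.measurable) one_pos
  simp only [div_one, Function.comp_apply, hcoe] at hsubst
  rw [← hsubst]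
  exact (Complex.volume_preserving_equiv_real_prod.symm.setLIntegral_comp_preimage_emb
    (MeasurableEquiv.measurableEmbedding _) f _).symm

lemma lintegral_upperHalfPlane {K : UpperHalfPlane → ℝ≥0∞} (hK : Measurable K) :
    ∫⁻ z, K z = ∫⁻ w, K (halfPlaneChart w) := by
  have him : Measurable fun z : UpperHalfPlane => NNReal.mk z.im z.im_pos.le :=
    UpperHalfPlane.continuous_im.measurable.subtype_mk
  have hρ : Measurable fun z : UpperHalfPlane =>
      (((1 / NNReal.mk z.im z.im_pos.le : NNReal) ^ 2 : NNReal) : ℝ≥0∞) :=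
    ((measurable_const.div him).pow_const 2).coe_nnreal_ennreal
  obtain ⟨G, hG, hGK⟩ := UpperHalfPlane.measurableEmbedding_coe.exists_measurable_extend
    (hρ.mul hK) fun _ => ⟨0⟩
  have hrange : Set.range UpperHalfPlane.coe = {z | 0 < z.im} := by
    ext z
    exact ⟨fun ⟨w, hw⟩ => hw ▸ w.im_pos, fun hz => ⟨⟨z, hz⟩, rfl⟩⟩
  rw [UpperHalfPlane.volume_def, lintegral_withDensity_eq_lintegral_mul _ hρ hK, ← hGK,
    Function.comp_def, ← lintegral_map hG UpperHalfPlane.measurable_coe,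
    UpperHalfPlane.measurableEmbedding_coe.map_comap, hrange, setLIntegral_im_pos hG]
  refine lintegral_congr fun w => ?_
  have hGw := congrFun hGK (halfPlaneChart w)
  have hw : (halfPlaneChart w).im = Real.exp (-w.2) := rfl
  have hexp : Real.exp (-(2 * w.2)) = Real.exp (-w.2) ^ 2 := by
    rw [← Real.exp_nat_mul]
    ring_nf
  simp only [Function.comp_apply, Pi.mul_apply, hw] at hGw
  rw [hGw, ← mul_assoc, ← ENNReal.ofReal_coe_nnreal, ← ENNReal.ofReal_mul (Real.exp_nonneg _)]
  simp only [NNReal.coe_pow, NNReal.coe_div, NNReal.coe_one, NNReal.coe_mk, hexp, ← mul_pow,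
    mul_one_div_cancel (Real.exp_ne_zero _), one_pow, ENNReal.ofReal_one, one_mul]

/-- The Möbius transformation `w ↦ s - 1 / w`. -/
def inversionMat (s : ℝ) : SL(2, ℝ) := ⟨!![s, -1; 1, 0], by simp [Matrix.det_fin_two_of]⟩

lemma coe_inversionMat_inv (s : ℝ) : ((inversionMat s)⁻¹).val = !![0, 1; -1, s] := by
  rw [Matrix.SpecialLinearGroup.coe_inv, inversionMat, Matrix.adjugate_fin_two_of, neg_neg]

lemma coe_inversionMat_inv_mul_horoChart (s t r : ℝ) : ((inversionMat s)⁻¹ * horoChart s t r).val =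
    !![-r * Real.exp (-t / 2), Real.exp (-t / 2); -(Real.exp (-t / 2))⁻¹, 0] := by
  rw [Matrix.SpecialLinearGroup.coe_mul, coe_inversionMat_inv, coe_horoChart, Matrix.mul_fin_two]
  ext i j
  fin_cases i <;> fin_cases j <;>
    simp only [Fin.zero_eta, Fin.mk_one, Matrix.of_apply, Matrix.cons_val', Matrix.cons_val_zero,
      Matrix.cons_val_one, Matrix.cons_val_fin_one] <;> ring

lemma horoChart_smul_I (s t r : ℝ) :
    horoChart s t r • UpperHalfPlane.I = inversionMat s • halfPlaneChart (r, t) := by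
  rw [← inv_smul_eq_iff, ← mul_smul]
  apply UpperHalfPlane.ext
  have hexp : Real.exp (-t) = Real.exp (-t / 2) * Real.exp (-t / 2) := by
    rw [← Real.exp_add, add_halves]
  have hne : (Real.exp (-t / 2) : ℂ) ≠ 0 := Complex.ofReal_ne_zero.2 (Real.exp_ne_zero _)
  have hcoe : (halfPlaneChart (r, t) : ℂ) = Real.exp (-t) * (r + Complex.I) := by
    change (⟨r * Real.exp (-t), Real.exp (-t)⟩ : ℂ) = _
    generalize Real.exp (-t) = y
    apply Complex.ext <;> simp [mul_comm]
  rw [UpperHalfPlane.coe_specialLinearGroup_apply, coe_inversionMat_inv_mul_horoChart, hcoe, hexp]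
  generalize Real.exp (-t / 2) = ε at hne ⊢
  simp only [Matrix.of_apply, Matrix.cons_val', Matrix.cons_val_zero, Matrix.cons_val_one,
    Matrix.cons_val_fin_one, Algebra.algebraMap_self_apply, Complex.ofReal_mul, Complex.ofReal_neg,
    Complex.ofReal_inv, Complex.ofReal_zero, add_zero, UpperHalfPlane.coe_I]
  field_simp
  linear_combination (-1) * Complex.I_sq

lemma im_inversionMat_inv_smul (s : ℝ) (z : UpperHalfPlane) :
    ((inversionMat s)⁻¹ • z).im = z.im / ((z.re - s) ^ 2 + z.im ^ 2) := by
  rw [← UpperHalfPlane.coe_im, UpperHalfPlane.coe_specialLinearGroup_apply, coe_inversionMat_inv]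
  simp only [Matrix.of_apply, Matrix.cons_val', Matrix.cons_val_zero, Matrix.cons_val_one,
    Matrix.cons_val_fin_one, Algebra.algebraMap_self_apply, Complex.ofReal_zero, Complex.ofReal_one,
    Complex.ofReal_neg, zero_mul, zero_add, neg_one_mul, one_div, Complex.inv_im,
    Complex.normSq_apply, Complex.add_re, Complex.add_im, Complex.neg_re, Complex.neg_im,
    Complex.ofReal_re, Complex.ofReal_im, UpperHalfPlane.coe_re, UpperHalfPlane.coe_im]
  ring

lemma lintegral_poisson_kernel (z : UpperHalfPlane) :
    ∫⁻ s : ℝ, ENNReal.ofReal (z.im / ((z.re - s) ^ 2 + z.im ^ 2)) = ENNReal.ofReal Real.pi := by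
  have hpos := z.im_pos
  rw [← lintegral_add_right_eq_self _ z.re,
    lintegral_eq_ofReal_mul_lintegral_comp_mul (by fun_prop) hpos,
    ← lintegral_const_mul' _ _ ENNReal.ofReal_ne_top, ← integral_univ_inv_one_add_sq,
    ofReal_integral_eq_lintegral_ofReal integrable_inv_one_add_sq
      (Filter.Eventually.of_forall fun x => by positivity)]
  refine lintegral_congr fun s => ?_
  rw [← ENNReal.ofReal_mul hpos.le, sub_add_cancel_right]
  congr 1
  field_simp
  ring

lemma measurePreserving_smul_upperHalfPlane (g : SL(2, ℝ)) :
    MeasurePreserving (fun z : UpperHalfPlane => g • z) :=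
  measurePreserving_smul (g : GL (Fin 2) ℝ) (volume : Measure UpperHalfPlane)

lemma measurable_smul_I : Measurable fun g : SL(2, ℝ) => g • UpperHalfPlane.I :=
  (continuous_id.smul continuous_const).measurable

/- For fixed `s`, the map `(r, t) ↦ horoChart s t r • i` is the chart `halfPlaneChart` followed by
`w ↦ s - 1 / w`, which turns the factor `e^{-t} = Im w` into the Poisson kernel. -/
lemma lintegral_horoChart_smul_I {H : UpperHalfPlane → ℝ≥0∞} (hH : Measurable H) (s : ℝ) :
    ∫⁻ t, ENNReal.ofReal (Real.exp (-t)) * ∫⁻ r, H (horoChart s t r • UpperHalfPlane.I) =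
      ∫⁻ z : UpperHalfPlane, ENNReal.ofReal (z.im / ((z.re - s) ^ 2 + z.im ^ 2)) * H z := by
  have hmeas : Measurable fun z : UpperHalfPlane =>
      ENNReal.ofReal z.im * H (inversionMat s • z) :=
    UpperHalfPlane.continuous_im.measurable.ennreal_ofReal.mul
      (hH.comp (measurePreserving_smul_upperHalfPlane _).measurable)
  have hchart : Measurable fun w : ℝ × ℝ => ENNReal.ofReal (Real.exp (-w.2)) *
      H (horoChart s w.2 w.1 • UpperHalfPlane.I) :=
    (by fun_prop : Measurable fun w : ℝ × ℝ => ENNReal.ofReal (Real.exp (-w.2))).mul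
      ((hH.comp measurable_smul_I).comp (by fun_prop))
  calc ∫⁻ t, ENNReal.ofReal (Real.exp (-t)) * ∫⁻ r, H (horoChart s t r • UpperHalfPlane.I)
      = ∫⁻ w : ℝ × ℝ, ENNReal.ofReal (Real.exp (-w.2)) *
          H (horoChart s w.2 w.1 • UpperHalfPlane.I) := by
        rw [Measure.volume_eq_prod, lintegral_prod_symm _ hchart.aemeasurable]
        simp only [lintegral_const_mul' _ _ ENNReal.ofReal_ne_top]
    _ = ∫⁻ z : UpperHalfPlane, ENNReal.ofReal z.im * H (inversionMat s • z) := by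
        rw [lintegral_upperHalfPlane hmeas]
        simp only [horoChart_smul_I]
        rfl
    _ = ∫⁻ z : UpperHalfPlane, ENNReal.ofReal (z.im / ((z.re - s) ^ 2 + z.im ^ 2)) * H z := by
        rw [← (measurePreserving_smul_upperHalfPlane (inversionMat s)⁻¹).lintegral_comp hmeas]
        simp only [smul_inv_smul, im_inversionMat_inv_smul]

lemma setLIntegral_haarSL_smul_I {H : UpperHalfPlane → ℝ≥0∞} (hH : Measurable H) :
    ∫⁻ g in {g | 0 < g 1 1}, H (g • UpperHalfPlane.I) ∂haarSL =
      ENNReal.ofReal Real.pi * ∫⁻ z, H z := by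
  have hHI : Measurable fun g : SL(2, ℝ) => H (g • UpperHalfPlane.I) := hH.comp measurable_smul_I
  have hfiber : Measurable fun w : ℝ × ℝ =>
      ∫⁻ r, H (horoChart w.1 w.2 r • UpperHalfPlane.I) :=
    (hHI.comp (by fun_prop) : Measurable fun p : (ℝ × ℝ) × ℝ =>
      H (horoChart p.1.1 p.1.2 p.2 • UpperHalfPlane.I)).lintegral_prod_right'
  have him := UpperHalfPlane.continuous_im.measurable
  have hre := UpperHalfPlane.continuous_re.measurable
  calc ∫⁻ g in {g | 0 < g 1 1}, H (g • UpperHalfPlane.I) ∂haarSL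
      = ∫⁻ s, ∫⁻ t, ENNReal.ofReal (Real.exp (-t)) *
          ∫⁻ r, H (horoChart s t r • UpperHalfPlane.I) := by
        rw [setLIntegral_haarSL hHI, Measure.volume_eq_prod, lintegral_prod _ (by fun_prop)]
    _ = ∫⁻ s : ℝ, ∫⁻ z : UpperHalfPlane,
          ENNReal.ofReal (z.im / ((z.re - s) ^ 2 + z.im ^ 2)) * H z := by
        simp only [lintegral_horoChart_smul_I hH]
    _ = ∫⁻ z : UpperHalfPlane, ∫⁻ s : ℝ,
          ENNReal.ofReal (z.im / ((z.re - s) ^ 2 + z.im ^ 2)) * H z :=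
        lintegral_lintegral_swap (by unfold Function.uncurry; fun_prop)
    _ = ENNReal.ofReal Real.pi * ∫⁻ z, H z := by
        rw [← lintegral_const_mul _ hH]
        refine lintegral_congr fun z => ?_
        rw [lintegral_mul_const _ (by fun_prop), lintegral_poisson_kernel]

lemma map_smul_I_restrict_haarSL :
    Measure.map (fun g : SL(2, ℝ) => g • UpperHalfPlane.I) (haarSL.restrict {g | 0 < g 1 1}) =
      ENNReal.ofReal Real.pi • volume :=
  Measure.ext_of_lintegral _ fun H hH => by
    rw [lintegral_map hH measurable_smul_I, setLIntegral_haarSL_smul_I hH, lintegral_smul_measure,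
      smul_eq_mul]

end HalfPlane

section InvariantSets

variable {G α : Type*} [Group G] [MulAction G α] [MeasurableSpace α] {μ : Measure α}
  [SMulInvariantMeasure G α μ] {U W : Set α}

lemma smulInvariantMeasure_restrict (hU : MeasurableSet U)
    (hinv : ∀ γ : G, (γ • ·) ⁻¹' U = U) : SMulInvariantMeasure G α (μ.restrict U) where
  measure_preimage_smul γ s hs := by
    rw [Measure.restrict_apply' hU, Measure.restrict_apply hs, ← hinv γ, ← Set.preimage_inter,
      hinv γ, measure_preimage_smul_of_nullMeasurableSet (hs.inter hU).nullMeasurableSet γ]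

variable [Countable G] [MeasurableConstSMul G α]

lemma measure_eq_measure_inter_of_isFundamentalDomain_restrict {S : Set α} (hU : MeasurableSet U)
    (hinv : ∀ γ : G, (γ • ·) ⁻¹' U = U) (hW : IsFundamentalDomain G W μ)
    (hS : IsFundamentalDomain G S (μ.restrict U)) (hSU : S ⊆ U) : μ S = μ (W ∩ U) := by
  have : SMulInvariantMeasure G α (μ.restrict U) := smulInvariantMeasure_restrict hU hinv
  have h := hS.measure_eq (hW.mono Measure.restrict_le_self.absolutelyContinuous)
  rwa [Measure.restrict_eq_self μ hSU, Measure.restrict_apply' hU] at h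

lemma preimage_ae_eq_of_subset_of_measure_inter_ne_top (hU : MeasurableSet U)
    (hinv : ∀ γ : G, (γ • ·) ⁻¹' U = U) (hW : IsFundamentalDomain G W μ) (hfin : μ (U ∩ W) ≠ ⊤)
    {T : α → α} (hT : MeasurePreserving T μ μ) (hcomm : ∀ (γ : G) x, T (γ • x) = γ • T x)
    (hsub : U ⊆ T ⁻¹' U) : T ⁻¹' U =ᵐ[μ] U := by
  have hTU : MeasurableSet (T ⁻¹' U) := hT.measurable hU
  have hTinv (γ : G) : (γ • ·) ⁻¹' (T ⁻¹' U) = T ⁻¹' U := by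
    rw [← Set.preimage_comp, (funext (hcomm γ) : T ∘ (γ • ·) = (γ • ·) ∘ T), Set.preimage_comp,
      hinv γ]
  have hTW : IsFundamentalDomain G (T ⁻¹' W) μ :=
    hW.preimage_of_equiv hT.quasiMeasurePreserving (e := id) Function.bijective_id hcomm
  have hmeas : μ (T ⁻¹' U ∩ W) = μ (U ∩ W) := by
    rw [hW.measure_set_eq hTW hTU hTinv, ← Set.preimage_inter,
      hT.measure_preimage (hU.nullMeasurableSet.inter hW.nullMeasurableSet)]
  have hdiff : μ (T ⁻¹' U \ U) = 0 := by
    refine hW.measure_zero_of_invariant _ (fun γ => ?_) ?_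
    · rw [← Set.preimage_smul_inv, Set.preimage_sdiff, hTinv, hinv]
    · rw [Set.inter_comm, Set.inter_sdiff_distrib_left, Set.inter_comm W, Set.inter_comm W,
        measure_sdiff (Set.inter_subset_inter_left W hsub)
          (hU.nullMeasurableSet.inter hW.nullMeasurableSet) hfin, hmeas, tsub_self]
  exact (ae_le_set.2 hdiff).antisymm hsub.eventuallyLE

end InvariantSets

section FundamentalDomain

open scoped Pointwise

variable {Γ : Subgroup SL(2, ℝ)}

lemma neg_one_mul_apply {n R : Type*} [Fintype n] [DecidableEq n] [CommRing R]
    [Fact (Even (Fintype.card n))] (g : Matrix.SpecialLinearGroup n R) (i j : n) :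
    (-1 * g) i j = -g i j := by
  rw [neg_one_mul]
  rfl

lemma neg_one_mul_smul (g : SL(2, ℝ)) (z : UpperHalfPlane) : (-1 * g) • z = g • z := by
  have hGL : ((-g : SL(2, ℝ)) : GL (Fin 2) ℝ) = -(g : GL (Fin 2) ℝ) := Units.ext rfl
  rw [neg_one_mul]
  change ((-g : SL(2, ℝ)) : GL (Fin 2) ℝ) • z = (g : GL (Fin 2) ℝ) • z
  rw [hGL, UpperHalfPlane.neg_smul]

lemma measurableSet_apply_one_one_pos : MeasurableSet {g : SL(2, ℝ) | 0 < g 1 1} :=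
  measurableSet_lt measurable_const (measurable_entry 1 1)

/-- The lift of a subset of the upper half-plane to `SL(2, ℝ)` modulo `-1`: of the two lifts `±g`,
the one with positive lower right entry is chosen. -/
def liftSet (F : Set UpperHalfPlane) : Set SL(2, ℝ) :=
  (fun g : SL(2, ℝ) => g • UpperHalfPlane.I) ⁻¹' F ∩ {g | 0 < g 1 1}

lemma measure_zero_of_inter_apply_one_one_pos {A : Set SL(2, ℝ)}
    (hneg : ∀ g ∈ A, -1 * g ∈ A) (h0 : haarSL (A ∩ {g | 0 < g 1 1}) = 0) : haarSL A = 0 := by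
  have hneg0 : haarSL ((-1 * ·) ⁻¹' (A ∩ {g | 0 < g 1 1})) = 0 := by
    rw [measure_preimage_mul, h0]
  rw [measure_eq_zero_iff_ae_notMem] at h0 hneg0 ⊢
  filter_upwards [h0, hneg0, ae_haarSL_apply_one_one_ne_zero] with g hpos hgneg hne hg
  rcases hne.lt_or_gt with hlt | hgt
  · refine hgneg ⟨hneg g hg, ?_⟩
    rw [Set.mem_ofPred_eq, neg_one_mul_apply]
    exact neg_pos.2 hlt
  · exact hpos ⟨hg, hgt⟩

lemma quasiMeasurePreserving_smul_I : Measure.QuasiMeasurePreserving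
    (fun g : SL(2, ℝ) => g • UpperHalfPlane.I) haarSL volume := by
  refine ⟨measurable_smul_I, Measure.AbsolutelyContinuous.mk fun N hN h0 => ?_⟩
  rw [Measure.map_apply measurable_smul_I hN]
  refine measure_zero_of_inter_apply_one_one_pos (fun g hg => ?_) ?_
  · rwa [Set.mem_preimage, neg_one_mul_smul]
  · rw [← Measure.restrict_apply (measurable_smul_I hN), ← Measure.map_apply measurable_smul_I hN,
      map_smul_I_restrict_haarSL, Measure.smul_apply, h0, smul_zero]

lemma haarSL_liftSet {F : Set UpperHalfPlane} (hF : NullMeasurableSet F) :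
    haarSL (liftSet F) = ENNReal.ofReal Real.pi * volume F := by
  rw [liftSet, ← Measure.restrict_apply' measurableSet_apply_one_one_pos,
    ← Measure.map_apply₀ measurable_smul_I.aemeasurable, map_smul_I_restrict_haarSL,
    Measure.smul_apply, smul_eq_mul]
  rw [map_smul_I_restrict_haarSL]
  exact hF.mono_ac Measure.smul_absolutelyContinuous

lemma eq_one_or_eq_neg_one_of_forall_smul_eq {γ : SL(2, ℝ)}
    (h : ∀ z : UpperHalfPlane, γ • z = z) : γ = 1 ∨ γ = -1 := by
  have hGL : (γ : GL (Fin 2) ℝ) ∈ Subgroup.center (GL (Fin 2) ℝ) :=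
    UpperHalfPlane.forall_smul_eq_self_iff_mem_center.1 h
  have hSL : γ ∈ Subgroup.center SL(2, ℝ) := Subgroup.mem_center_iff.2 fun g =>
    Matrix.SpecialLinearGroup.toGL_injective <| by
      simpa only [map_mul] using Subgroup.mem_center_iff.1 hGL (g : GL (Fin 2) ℝ)
  obtain ⟨r, hr, hγ⟩ := Matrix.SpecialLinearGroup.mem_center_iff.1 hSL
  rw [Fintype.card_fin, sq_eq_one_iff] at hr
  refine hr.imp ?_ ?_ <;> rintro rfl <;> apply Subtype.ext <;> rw [← hγ]
  exacts [map_one _, (map_neg _ _).trans (congrArg _ (map_one _))]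

lemma ae_exists_smul_mem_liftSet [Countable Γ] (hneg : (-1 : SL(2, ℝ)) ∈ Γ)
    {F : Set UpperHalfPlane} (hF : IsFundamentalDomain (moebiusGroup Γ) F) :
    ∀ᵐ g ∂haarSL, ∃ γ : Γ, γ • g ∈ liftSet F := by
  have hne : ∀ᵐ g ∂haarSL, ∀ γ : Γ, ((γ : SL(2, ℝ)) * g) 1 1 ≠ 0 := ae_all_iff.2 fun γ =>
    (measurePreserving_mul_left_haarSL γ).quasiMeasurePreserving.ae ae_haarSL_apply_one_one_ne_zero
  filter_upwards [hne, quasiMeasurePreserving_smul_I.ae hF.ae_covers] with g hg hcov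
  obtain ⟨⟨_, γ, hγ, rfl⟩, hm⟩ := hcov
  replace hm : (γ * g) • UpperHalfPlane.I ∈ F := by rwa [mul_smul]
  rcases (hg ⟨γ, hγ⟩).lt_or_gt with hlt | hgt
  · refine ⟨⟨-1 * γ, Γ.mul_mem hneg hγ⟩, ?_, ?_⟩
    · change (-1 * γ * g) • UpperHalfPlane.I ∈ F
      rwa [mul_assoc, neg_one_mul_smul]
    · change 0 < (-1 * γ * g) 1 1
      rw [mul_assoc, neg_one_mul_apply]
      exact neg_pos.2 hlt
  · exact ⟨⟨γ, hγ⟩, hm, hgt⟩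

lemma aedisjoint_smul_liftSet {F : Set UpperHalfPlane}
    (hF : IsFundamentalDomain (moebiusGroup Γ) F) {γ : Γ} (hγ : γ ≠ 1) :
    AEDisjoint haarSL (γ • liftSet F) (liftSet F) := by
  let m : moebiusGroup Γ := ⟨MulAction.toPermHom SL(2, ℝ) UpperHalfPlane γ, γ, γ.2, rfl⟩
  by_cases hm : m = 1
  · have hγneg : (γ : SL(2, ℝ)) = -1 :=
      (eq_one_or_eq_neg_one_of_forall_smul_eq fun z =>
        congrArg (fun m : moebiusGroup Γ => m • z) hm).resolve_left fun h => hγ (Subtype.ext h)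
    refine Disjoint.aedisjoint (Set.disjoint_left.2 ?_)
    rintro _ ⟨g, hg, rfl⟩ hg'
    have hpos : 0 < g 1 1 := hg.2
    have hpos' : 0 < ((γ : SL(2, ℝ)) * g) 1 1 := hg'.2
    rw [hγneg, neg_one_mul_apply] at hpos'
    linarith
  · have hdisj : volume (m • F ∩ F) = 0 := by
      have : AEDisjoint volume (m • F) F := by
        simpa only [Function.onFun, one_smul] using hF.aedisjoint hm
      exact this
    refine measure_mono_null ?_ (quasiMeasurePreserving_smul_I.preimage_null hdisj)
    rintro _ ⟨⟨g, hg, rfl⟩, hg'⟩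
    exact ⟨⟨g • UpperHalfPlane.I, hg.1, (mul_smul (γ : SL(2, ℝ)) g _).symm⟩, hg'.1⟩

lemma isFundamentalDomain_liftSet [Countable Γ] (hneg : (-1 : SL(2, ℝ)) ∈ Γ)
    {F : Set UpperHalfPlane} (hF : IsFundamentalDomain (moebiusGroup Γ) F) :
    IsFundamentalDomain Γ (liftSet F) haarSL :=
  .mk'' ((hF.nullMeasurableSet.preimage quasiMeasurePreserving_smul_I).inter
      measurableSet_apply_one_one_pos.nullMeasurableSet)
    (ae_exists_smul_mem_liftSet hneg hF) (fun _ => aedisjoint_smul_liftSet hF)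
    fun γ => (measurePreserving_smul γ haarSL).quasiMeasurePreserving

end FundamentalDomain

section PastHits

variable {Γ : Subgroup SL(2, ℝ)}

/-- The set of `g` whose orbit under the unstable horocycle flow has met the section `ℋ(0)` by
time `0`; it is the union of the `Γ`-translates of `suspension Γ`. -/
def pastHitSet (Γ : Subgroup SL(2, ℝ)) : Set SL(2, ℝ) := {g | ∃ r ∈ hitTimes Γ g, r ≤ 0}

lemma mem_pastHitSet {g : SL(2, ℝ)} : g ∈ pastHitSet Γ ↔
    ∃ γ ∈ Γ, 0 < (γ * g) 1 1 ∧ (γ * g) 1 1 ≤ 1 ∧ (γ * g) 1 0 ≤ 0 := by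
  constructor
  · rintro ⟨r, hr, hr0⟩
    obtain ⟨γ, hγ, h10, hpos, hle⟩ := mem_hitTimes.1 hr
    exact ⟨γ, hγ, hpos, hle, h10.trans_le (mul_nonpos_of_nonpos_of_nonneg hr0 hpos.le)⟩
  · rintro ⟨γ, hγ, hpos, hle, h10⟩
    exact ⟨_, div_mem_hitTimes hγ hpos hle, div_nonpos_of_nonpos_of_nonneg h10 hpos.le⟩

lemma preimage_smul_pastHitSet (γ : Γ) : (γ • ·) ⁻¹' pastHitSet Γ = pastHitSet Γ :=
  Set.ext fun g => exists_congr fun r => and_congr_left fun _ =>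
    iff_of_eq (congrArg (r ∈ ·) (hitTimes_mul_left γ.2 g))

lemma measurableSet_pastHitSet [Countable Γ] : MeasurableSet (pastHitSet Γ) := by
  have hunion : pastHitSet Γ = ⋃ γ : Γ, {g | 0 < ((γ : SL(2, ℝ)) * g) 1 1 ∧
      ((γ : SL(2, ℝ)) * g) 1 1 ≤ 1 ∧ ((γ : SL(2, ℝ)) * g) 1 0 ≤ 0} := by
    ext g
    simp only [mem_pastHitSet, Set.mem_iUnion, Set.mem_ofPred_eq, Subtype.exists, exists_prop]
  have hentry (γ : Γ) (j : Fin 2) : Measurable fun g => ((γ : SL(2, ℝ)) * g) 1 j :=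
    (measurable_entry 1 j).comp (measurable_const_mul _)
  rw [hunion]
  exact .iUnion fun γ => (measurableSet_lt measurable_const (hentry γ 1)).inter
    ((measurableSet_le (hentry γ 1) measurable_const).inter
      (measurableSet_le (hentry γ 0) measurable_const))

lemma mul_lowMat_mul_aMat_mem_pastHitSet {g : SL(2, ℝ)} {x : ℝ} :
    g * lowMat (-x) * aMat (2 * x) ∈ pastHitSet Γ ↔
      ∃ γ ∈ Γ, 0 < (γ * g) 1 1 ∧ (γ * g) 1 1 ≤ Real.exp x ∧ (γ * g) 1 0 ≤ x * (γ * g) 1 1 := by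
  have hexp : Real.exp (-(2 * x) / 2) = (Real.exp x)⁻¹ := by
    rw [← Real.exp_neg]
    ring_nf
  have hx := Real.exp_pos x
  refine mem_pastHitSet.trans (exists_congr fun γ => and_congr_right fun _ => ?_)
  rw [← mul_assoc, ← mul_assoc, mul_aMat_apply_one_one, mul_aMat_apply_one_zero,
    mul_lowMat_apply_one_one, mul_lowMat_apply_one_zero, hexp, mul_div_cancel_left₀ x two_ne_zero,
    mul_pos_iff_of_pos_left (inv_pos.2 hx), inv_mul_le_one₀ hx,
    ← smul_eq_mul (Real.exp x), smul_nonpos_iff_nonpos_of_pos_left hx, neg_mul,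
    ← sub_eq_add_neg, sub_nonpos]

lemma mul_lowMat_mul_aMat_mem_pastHitSet_of_mem {g : SL(2, ℝ)} (hg : g ∈ pastHitSet Γ) {x : ℝ}
    (hx : 0 ≤ x) : g * lowMat (-x) * aMat (2 * x) ∈ pastHitSet Γ := by
  obtain ⟨γ, hγ, hpos, hle, h10⟩ := mem_pastHitSet.1 hg
  exact mul_lowMat_mul_aMat_mem_pastHitSet.2 ⟨γ, hγ, hpos, hle.trans (Real.one_le_exp hx),
    h10.trans (mul_nonneg hx hpos.le)⟩

lemma exists_nat_mul_lowMat_mul_aMat_mem_pastHitSet (hneg : (-1 : SL(2, ℝ)) ∈ Γ) {g : SL(2, ℝ)}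
    (hg : g 1 1 ≠ 0) : ∃ n : ℕ, g * lowMat (-n) * aMat (2 * n) ∈ pastHitSet Γ := by
  obtain ⟨γ, hγ, hpos⟩ : ∃ γ ∈ Γ, 0 < (γ * g) 1 1 := by
    rcases hg.lt_or_gt with hlt | hgt
    · exact ⟨-1, hneg, by rw [neg_one_mul_apply]; exact neg_pos.2 hlt⟩
    · exact ⟨1, Γ.one_mem, by rwa [one_mul]⟩
  obtain ⟨n, hn⟩ := exists_nat_ge (max ((γ * g) 1 1) ((γ * g) 1 0 / (γ * g) 1 1))
  refine ⟨n, mul_lowMat_mul_aMat_mem_pastHitSet.2 ⟨γ, hγ, hpos, ?_, ?_⟩⟩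
  · linarith [Real.add_one_le_exp (n : ℝ), (le_max_left _ _).trans hn]
  · exact (div_le_iff₀ hpos).1 ((le_max_right _ _).trans hn)

lemma ae_mem_pastHitSet [Countable Γ] (hneg : (-1 : SL(2, ℝ)) ∈ Γ) {W : Set SL(2, ℝ)}
    (hW : IsFundamentalDomain Γ W haarSL) (hfin : haarSL (pastHitSet Γ ∩ W) ≠ ⊤) :
    ∀ᵐ g ∂haarSL, g ∈ pastHitSet Γ := by
  have hsweep (n : ℕ) :
      (fun g => g * lowMat (-n) * aMat (2 * n)) ⁻¹' pastHitSet Γ =ᵐ[haarSL] pastHitSet Γ :=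
    preimage_ae_eq_of_subset_of_measure_inter_ne_top measurableSet_pastHitSet
      preimage_smul_pastHitSet hW hfin
      ((measurePreserving_mul_aMat (2 * n)).comp (measurePreserving_mul_lowMat (-n)))
      (fun γ g => by simp only [Subgroup.smul_def, smul_eq_mul, mul_assoc])
      fun g hg => mul_lowMat_mul_aMat_mem_pastHitSet_of_mem hg n.cast_nonneg
  filter_upwards [ae_all_iff.2 fun n => (hsweep n).mem_iff, ae_haarSL_apply_one_one_ne_zero]
    with g hiff hg
  obtain ⟨n, hn⟩ := exists_nat_mul_lowMat_mul_aMat_mem_pastHitSet hneg hg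
  exact (hiff n).1 hn

end PastHits

section MeasurableReturnTime

variable {Γ : Subgroup SL(2, ℝ)}

open Classical in
lemma firstPositive_hitTimes_eq_iInf (g : SL(2, ℝ)) :
    firstPositive (hitTimes Γ g) = ⨅ γ : Γ,
      if 0 < ((γ : SL(2, ℝ)) * g) 1 1 ∧ ((γ : SL(2, ℝ)) * g) 1 1 ≤ 1 ∧
        0 < ((γ : SL(2, ℝ)) * g) 1 0
      then ENNReal.ofReal (((γ : SL(2, ℝ)) * g) 1 0 / ((γ : SL(2, ℝ)) * g) 1 1) else ⊤ := by
  apply le_antisymm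
  · refine le_iInf fun γ => ?_
    split_ifs with h
    · exact iInf₂_le _ ⟨div_mem_hitTimes γ.2 h.1 h.2.1, div_pos h.2.2 h.1⟩
    · exact le_top
  · refine le_iInf₂ fun r hr => ?_
    obtain ⟨γ, hγ, h10, hpos, hle⟩ := mem_hitTimes.1 hr.1
    refine iInf_le_of_le ⟨γ, hγ⟩ (le_of_eq ?_)
    rw [if_pos ⟨hpos, hle, h10 ▸ mul_pos hr.2 hpos⟩, h10, mul_div_cancel_right₀ _ hpos.ne']

lemma measurable_firstPositive_hitTimes [Countable Γ] :
    Measurable fun g => firstPositive (hitTimes Γ g) := by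
  have hentry (γ : Γ) (j : Fin 2) : Measurable fun g => ((γ : SL(2, ℝ)) * g) 1 j :=
    (measurable_entry 1 j).comp (measurable_const_mul _)
  simp only [firstPositive_hitTimes_eq_iInf]
  refine .iInf fun γ => .ite ?_ ((hentry γ 0).div (hentry γ 1)).ennreal_ofReal measurable_const
  exact (measurableSet_lt measurable_const (hentry γ 1)).inter
    ((measurableSet_le (hentry γ 1) measurable_const).inter
      (measurableSet_lt measurable_const (hentry γ 0)))

lemma measurable_returnTime [Countable Γ] : Measurable (returnTime Γ) := by
  have hreturn : returnTime Γ = fun w => firstPositive (hitTimes Γ (horoChart w.1 w.2 0)) :=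
    funext fun w => by rw [returnTime_eq_firstPositive, horoChart_zero]
  rw [hreturn]
  exact measurable_firstPositive_hitTimes.comp (by fun_prop)

end MeasurableReturnTime

section Cusp

variable {Γ : Subgroup SL(2, ℝ)}

lemma HasWidthOneCuspAtInfinity.nMat_intCast_mem (h : HasWidthOneCuspAtInfinity Γ) (k : ℤ) :
    nMat k ∈ Γ := (h k).2 ⟨k, rfl⟩

lemma HasWidthOneCuspAtInfinity.nMat_one_mem (h : HasWidthOneCuspAtInfinity Γ) : nMat 1 ∈ Γ :=
  (h 1).2 ⟨1, Int.cast_one.symm⟩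

lemma HasWidthOneCuspAtInfinity.exists_apply_one_one_sq_eq_intCast
    (h : HasWidthOneCuspAtInfinity Γ) {γ : SL(2, ℝ)} (hγ : γ ∈ Γ) (h10 : γ 1 0 = 0) :
    ∃ k : ℤ, γ 1 1 ^ 2 = k := by
  have hconj : γ⁻¹ * nMat 1 * γ = nMat (γ 1 1 ^ 2) := by
    apply Subtype.ext
    rw [coe_inv_mul_nMat_mul, coe_nMat, h10]
    simp
  exact (h _).1 (hconj ▸ Γ.mul_mem (Γ.mul_mem (Γ.inv_mem hγ) h.nMat_one_mem) hγ)

lemma HasWidthOneCuspAtInfinity.apply_one_one_eq_one (h : HasWidthOneCuspAtInfinity Γ)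
    {γ : SL(2, ℝ)} (hγ : γ ∈ Γ) (h10 : γ 1 0 = 0) (hpos : 0 < γ 1 1) : γ 1 1 = 1 := by
  have hinv : (γ⁻¹).val = !![γ 1 1, -γ 0 1; -γ 1 0, γ 0 0] := by
    rw [Matrix.SpecialLinearGroup.coe_inv, Matrix.adjugate_fin_two]
  have hdet : γ 0 0 * γ 1 1 = 1 := by linarith [det_eq_one γ, congrArg (γ 0 1 * ·) h10]
  obtain ⟨k, hk⟩ := h.exists_apply_one_one_sq_eq_intCast hγ h10
  obtain ⟨l, hl⟩ := h.exists_apply_one_one_sq_eq_intCast (Γ.inv_mem hγ) (by simp [hinv, h10])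
  have hl' : γ 0 0 ^ 2 = l := by simpa [hinv] using hl
  have hlk : l * k = 1 := by
    have : (l : ℝ) * k = 1 := by rw [← hk, ← hl', ← mul_pow, hdet, one_pow]
    exact_mod_cast this
  have hk0 : 0 ≤ k := by
    have : (0 : ℝ) ≤ k := hk ▸ sq_nonneg _
    exact_mod_cast this
  rw [Int.eq_one_of_mul_eq_one_left hk0 hlk, Int.cast_one] at hk
  exact (pow_eq_one_iff_of_nonneg hpos.le two_ne_zero).1 hk

lemma HasWidthOneCuspAtInfinity.exists_eq_nMat (h : HasWidthOneCuspAtInfinity Γ) {γ : SL(2, ℝ)}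
    (hγ : γ ∈ Γ) (h10 : γ 1 0 = 0) (hpos : 0 < γ 1 1) : ∃ k : ℤ, γ = nMat k := by
  have h11 := h.apply_one_one_eq_one hγ h10 hpos
  have h00 : γ 0 0 = 1 := by simpa [h10, h11] using det_eq_one γ
  have hγn : γ = nMat (γ 0 1) := by
    ext i j
    fin_cases i <;> fin_cases j <;> simp [coe_nMat, h10, h11, h00]
  obtain ⟨k, hk⟩ := (h (γ 0 1)).1 (hγn ▸ hγ)
  exact ⟨k, hk ▸ hγn⟩

lemma eq_one_of_mul_horoChart_eq_horoChart (hcusp : HasWidthOneCuspAtInfinity Γ) {γ : SL(2, ℝ)}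
    (hγ : γ ∈ Γ) {s t s' t' r : ℝ} (hs : s ∈ Set.Ico (0 : ℝ) 1) (hs' : s' ∈ Set.Ico (0 : ℝ) 1)
    (h : γ * horoChart s t r = horoChart s' t' r) : γ = 1 := by
  have hmul : γ * horoChart s t 0 = horoChart s' t' 0 := by
    rw [horoChart_zero, horoChart_zero]
    refine mul_right_cancel (b := lowMat (-r)) ?_
    rwa [mul_assoc]
  have hentries : !![γ 0 0, γ 0 1; γ 1 0, γ 1 1] * (horoChart s t 0).val =
      (horoChart s' t' 0).val := by
    rw [← hmul, Matrix.SpecialLinearGroup.coe_mul, ← Matrix.eta_fin_two γ.val]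
  rw [coe_horoChart, coe_horoChart, Matrix.mul_fin_two] at hentries
  have h10 : γ 1 0 = 0 := by simpa using congrFun (congrFun hentries 1) 0
  have h11 : γ 1 1 * Real.exp (-t / 2) = Real.exp (-t' / 2) := by
    simpa [h10] using congrFun (congrFun hentries 1) 1
  obtain ⟨k, rfl⟩ := hcusp.exists_eq_nMat hγ h10
    (pos_of_mul_pos_left (h11 ▸ Real.exp_pos _) (Real.exp_pos (-t / 2)).le)
  have hk : s + k = s' := by
    rw [← coordS_horoChart s' t' r, ← h, horoChart, ← mul_assoc, ← mul_assoc, ← nMat_add,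
      ← horoChart, coordS_horoChart, add_comm]
  obtain ⟨hs0, hs1⟩ := hs
  obtain ⟨hs0', hs1'⟩ := hs'
  have hk1 : k < 1 := by exact_mod_cast (by linarith : (k : ℝ) < 1)
  have hk2 : -1 < k := by exact_mod_cast (by linarith : (-1 : ℝ) < k)
  rw [show k = 0 by omega, Int.cast_zero, nMat_zero]

end Cusp

section Suspension

variable {Γ : Subgroup SL(2, ℝ)}

/-- The set of `n(s) a(t) (1 0; -r 1)` with `(s, t) ∈ Σ` and `0 ≤ r < η₁(s, t)`: the suspension of
the section under the first return time, lifted to `SL(2, ℝ)`. -/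
def suspension (Γ : Subgroup SL(2, ℝ)) : Set SL(2, ℝ) :=
  {g | 0 < g 1 1 ∧ (coordS g, coordT g) ∈ paramSpace ∧ 0 ≤ coordR g ∧
    ENNReal.ofReal (coordR g) < returnTime Γ (coordS g, coordT g)}

lemma horoChart_mem_suspension {s t r : ℝ} : horoChart s t r ∈ suspension Γ ↔
    (s, t) ∈ paramSpace ∧ 0 ≤ r ∧ ENNReal.ofReal r < returnTime Γ (s, t) := by
  have hpos : 0 < horoChart s t r 1 1 := by
    simpa [coe_horoChart] using Real.exp_pos (-t / 2)
  rw [suspension, Set.mem_ofPred_eq, coordS_horoChart, coordT_horoChart, coordR_horoChart,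
    and_iff_right hpos]

lemma measurableSet_paramSpace : MeasurableSet paramSpace :=
  measurableSet_Ico.prod measurableSet_Ici

lemma measurableSet_suspension [Countable Γ] : MeasurableSet (suspension Γ) := by
  have hS : Measurable coordS := (measurable_entry 0 1).div (measurable_entry 1 1)
  have hT : Measurable coordT := (measurable_entry 1 1).log.const_mul (-2)
  have hR : Measurable coordR := (measurable_entry 1 0).neg.div (measurable_entry 1 1)
  exact measurableSet_apply_one_one_pos.inter (((hS.prodMk hT) measurableSet_paramSpace).inter
    ((measurableSet_le measurable_const hR).inter
      (measurableSet_lt hR.ennreal_ofReal (measurable_returnTime.comp (hS.prodMk hT)))))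

lemma neg_mem_hitTimes_horoChart (s : ℝ) {t : ℝ} (ht : 0 ≤ t) (r : ℝ) :
    -r ∈ hitTimes Γ (horoChart s t r) := by
  rw [horoChart, mem_hitTimes_mul_lowMat_neg, add_neg_cancel, mem_hitTimes_iff_toX, neg_zero,
    lowMat_zero, mul_one, toX_mem_section_iff_exists_nMat_mul_aMat]
  exact ⟨t, ht, s, 1, Γ.one_mem, one_mul _⟩

lemma ofReal_lt_returnTime_iff_forall_hitTimes_horoChart [DiscreteTopology Γ] (hΓ : nMat 1 ∈ Γ)
    {s t r : ℝ} (hr : 0 ≤ r) : ENNReal.ofReal r < returnTime Γ (s, t) ↔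
      ∀ r' ∈ hitTimes Γ (horoChart s t r), -r < r' → 0 < r' := by
  rw [lt_returnTime_iff hΓ hr]
  simp only [horoChart, mem_hitTimes_mul_lowMat_neg]
  constructor
  · intro h r' hr' hlt
    linarith [h _ hr' (by linarith)]
  · intro h r' hr' hpos
    linarith [h (r' - r) (by rwa [add_sub_cancel]) (by linarith)]

lemma mem_suspension_iff [DiscreteTopology Γ] (hΓ : nMat 1 ∈ Γ) {g : SL(2, ℝ)} :
    g ∈ suspension Γ ↔ 0 < g 1 1 ∧ (coordS g, coordT g) ∈ paramSpace ∧
      IsGreatest {r ∈ hitTimes Γ g | r ≤ 0} (-coordR g) := by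
  refine and_congr_right fun hpos => and_congr_right fun hw => ?_
  have hhit : -coordR g ∈ hitTimes Γ g := by
    simpa only [horoChart_coord hpos] using neg_mem_hitTimes_horoChart (coordS g) hw.2 (coordR g)
  constructor
  · rintro ⟨hr, hlt⟩
    rw [ofReal_lt_returnTime_iff_forall_hitTimes_horoChart hΓ hr, horoChart_coord hpos] at hlt
    exact ⟨⟨hhit, neg_nonpos.2 hr⟩, fun r hr' => le_of_not_gt fun h => (hlt r hr'.1 h).not_ge hr'.2⟩
  · rintro ⟨⟨-, hr⟩, hmax⟩
    rw [neg_nonpos] at hr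
    rw [ofReal_lt_returnTime_iff_forall_hitTimes_horoChart hΓ hr, horoChart_coord hpos]
    exact ⟨hr, fun r hr' h => lt_of_not_ge fun h0 => h.not_ge (hmax ⟨hr', h0⟩)⟩

lemma eq_one_of_mul_mem_suspension [DiscreteTopology Γ] (hcusp : HasWidthOneCuspAtInfinity Γ)
    {g γ : SL(2, ℝ)} (hγ : γ ∈ Γ) (hg : g ∈ suspension Γ) (hg' : γ * g ∈ suspension Γ) :
    γ = 1 := by
  obtain ⟨hpos, hw, hgreatest⟩ := (mem_suspension_iff hcusp.nMat_one_mem).1 hg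
  obtain ⟨hpos', hw', hgreatest'⟩ := (mem_suspension_iff hcusp.nMat_one_mem).1 hg'
  rw [hitTimes_mul_left hγ] at hgreatest'
  have hR : coordR (γ * g) = coordR g := neg_injective (hgreatest'.unique hgreatest)
  refine eq_one_of_mul_horoChart_eq_horoChart hcusp hγ hw.1 hw'.1
    (t := coordT g) (t' := coordT (γ * g)) (r := coordR g) ?_
  rw [horoChart_coord hpos, ← hR, horoChart_coord hpos']

lemma exists_isGreatest_hitTimes [DiscreteTopology Γ] (hΓ : nMat 1 ∈ Γ) {g : SL(2, ℝ)}
    (hg : g ∈ pastHitSet Γ) : ∃ r, IsGreatest {r ∈ hitTimes Γ g | r ≤ 0} r := by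
  obtain ⟨r₀, hr₀, hle⟩ := hg
  have hfinite : (hitTimes Γ g ∩ Set.Icc r₀ 0).Finite :=
    (finite_hitTimes_inter_Icc hΓ g (-r₀)).subset <| Set.inter_subset_inter_right _ <|
      Set.Icc_subset_Icc (neg_neg r₀).le (neg_nonneg.2 hle)
  obtain ⟨r, ⟨hr, hrI⟩, hmax⟩ := Set.exists_max_image _ id hfinite ⟨r₀, hr₀, le_rfl, hle⟩
  exact ⟨r, ⟨hr, hrI.2⟩, fun r' hr' => (le_total r₀ r').elim
    (fun h => hmax r' ⟨hr'.1, h, hr'.2⟩) fun h => h.trans hrI.1⟩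

lemma exists_mul_eq_horoChart_of_mem_hitTimes (hcusp : HasWidthOneCuspAtInfinity Γ)
    {g : SL(2, ℝ)} {r : ℝ} (hr : r ∈ hitTimes Γ g) :
    ∃ γ ∈ Γ, ∃ s t, (s, t) ∈ paramSpace ∧ γ * g = horoChart s t (-r) := by
  obtain ⟨t, ht, s, γ, hγ, h⟩ := toX_mem_section_iff_exists_nMat_mul_aMat.1 hr
  refine ⟨nMat ((-⌊s⌋ : ℤ) : ℝ) * γ, Γ.mul_mem (hcusp.nMat_intCast_mem _) hγ, Int.fract s, t,
    ⟨⟨Int.fract_nonneg s, Int.fract_lt_one s⟩, ht⟩, ?_⟩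
  have hfract : ((-⌊s⌋ : ℤ) : ℝ) + s = Int.fract s := by
    rw [Int.cast_neg, neg_add_eq_sub, Int.self_sub_floor]
  calc nMat ((-⌊s⌋ : ℤ) : ℝ) * γ * g
      = nMat ((-⌊s⌋ : ℤ) : ℝ) * (γ * (g * lowMat (-r))) * lowMat r := by
        simp only [mul_assoc, ← lowMat_add, neg_add_cancel, lowMat_zero, mul_one]
    _ = horoChart (Int.fract s) t (-r) := by
        rw [h, ← mul_assoc, ← nMat_add, hfract, horoChart, neg_neg]

lemma exists_mul_mem_suspension [DiscreteTopology Γ] (hcusp : HasWidthOneCuspAtInfinity Γ)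
    {g : SL(2, ℝ)} (hg : g ∈ pastHitSet Γ) : ∃ γ ∈ Γ, γ * g ∈ suspension Γ := by
  obtain ⟨r, ⟨hr, hr0⟩, hmax⟩ := exists_isGreatest_hitTimes hcusp.nMat_one_mem hg
  obtain ⟨γ, hγ, s, t, hw, hchart⟩ := exists_mul_eq_horoChart_of_mem_hitTimes hcusp hr
  have hr0' : 0 ≤ -r := neg_nonneg.2 hr0
  refine ⟨γ, hγ, ?_⟩
  rw [hchart, horoChart_mem_suspension,
    ofReal_lt_returnTime_iff_forall_hitTimes_horoChart hcusp.nMat_one_mem hr0', ← hchart,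
    hitTimes_mul_left hγ, neg_neg]
  exact ⟨hw, hr0', fun r' hr' hlt => lt_of_not_ge fun h => hlt.not_ge (hmax ⟨hr', h⟩)⟩

lemma suspension_subset_pastHitSet [DiscreteTopology Γ] (hΓ : nMat 1 ∈ Γ) :
    suspension Γ ⊆ pastHitSet Γ :=
  fun _ hg => ⟨_, ((mem_suspension_iff hΓ).1 hg).2.2.1⟩

lemma isFundamentalDomain_suspension [DiscreteTopology Γ] (hcusp : HasWidthOneCuspAtInfinity Γ) :
    IsFundamentalDomain Γ (suspension Γ) (haarSL.restrict (pastHitSet Γ)) := by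
  have := countable_of_discreteTopology Γ
  have : SMulInvariantMeasure Γ SL(2, ℝ) (haarSL.restrict (pastHitSet Γ)) :=
    smulInvariantMeasure_restrict measurableSet_pastHitSet preimage_smul_pastHitSet
  refine .mk'' measurableSet_suspension.nullMeasurableSet ?_ ?_ fun γ =>
    (measurePreserving_smul γ _).quasiMeasurePreserving
  · refine (ae_restrict_iff' measurableSet_pastHitSet).2 (.of_forall fun g hg => ?_)
    obtain ⟨γ, hγ, h⟩ := exists_mul_mem_suspension hcusp hg
    exact ⟨⟨γ, hγ⟩, h⟩
  · rintro ⟨γ, hγ⟩ hne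
    refine Disjoint.aedisjoint (Set.disjoint_left.2 ?_)
    rintro _ ⟨g, hg, rfl⟩ hg'
    exact hne (Subtype.ext (eq_one_of_mul_mem_suspension hcusp hγ hg hg'))

end Suspension

section MeanReturnTime

variable {Γ : Subgroup SL(2, ℝ)}

lemma volume_setOf_horoChart_mem_suspension (w : ℝ × ℝ) :
    volume {r | horoChart w.1 w.2 r ∈ suspension Γ} = paramSpace.indicator (returnTime Γ) w := by
  simp only [horoChart_mem_suspension]
  by_cases hw : w ∈ paramSpace
  · simp only [hw, true_and, Set.indicator_of_mem, volume_setOf_nonneg_and_ofReal_lt]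
  · simp only [hw, false_and, Set.ofPred_false, measure_empty, Set.indicator_of_notMem,
      not_false_eq_true]

lemma haarSL_suspension [Countable Γ] : haarSL (suspension Γ) = meanReturnTime Γ := by
  have hmeas := measurableSet_suspension (Γ := Γ)
  have hexp : Measurable fun w : ℝ × ℝ => ENNReal.ofReal (Real.exp (-w.2)) := by fun_prop
  have hfiber (w : ℝ × ℝ) : ∫⁻ r, (suspension Γ).indicator 1 (horoChart w.1 w.2 r) =
      paramSpace.indicator (returnTime Γ) w := by
    rw [← volume_setOf_horoChart_mem_suspension]
    exact lintegral_indicator_one (hmeas.preimage (by fun_prop))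
  calc haarSL (suspension Γ)
      = ∫⁻ g in {g | 0 < g 1 1}, (suspension Γ).indicator 1 g ∂haarSL := by
        rw [lintegral_indicator_one hmeas, Measure.restrict_eq_self _ fun g hg => hg.1]
    _ = ∫⁻ w : ℝ × ℝ, ENNReal.ofReal (Real.exp (-w.2)) *
          paramSpace.indicator (returnTime Γ) w := by
        simp only [setLIntegral_haarSL (measurable_one.indicator hmeas), hfiber]
    _ = meanReturnTime Γ := by
        simp only [← Set.indicator_mul_right paramSpace fun w : ℝ × ℝ =>
          ENNReal.ofReal (Real.exp (-w.2))]
        rw [lintegral_indicator measurableSet_paramSpace, meanReturnTime, nu,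
          lintegral_withDensity_eq_lintegral_mul _ hexp measurable_returnTime]
        rfl

/- If the suspension has infinite measure, so does the lift of `F`, which is at least as large;
otherwise almost every `g` has a past hit and the two have the same measure. -/
lemma meanReturnTime_eq_pi_mul_volume [DiscreteTopology Γ] (hneg : (-1 : SL(2, ℝ)) ∈ Γ)
    (hcusp : HasWidthOneCuspAtInfinity Γ) {F : Set UpperHalfPlane}
    (hF : IsFundamentalDomain (moebiusGroup Γ) F) :
    meanReturnTime Γ = ENNReal.ofReal Real.pi * volume F := by
  have := countable_of_discreteTopology Γ
  have hW := isFundamentalDomain_liftSet hneg hF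
  have hmean : meanReturnTime Γ = haarSL (liftSet F ∩ pastHitSet Γ) := by
    rw [← haarSL_suspension]
    exact measure_eq_measure_inter_of_isFundamentalDomain_restrict measurableSet_pastHitSet
      preimage_smul_pastHitSet hW (isFundamentalDomain_suspension hcusp)
      (suspension_subset_pastHitSet hcusp.nMat_one_mem)
  rw [hmean, ← haarSL_liftSet hF.nullMeasurableSet]
  by_cases hfin : haarSL (pastHitSet Γ ∩ liftSet F) = ⊤
  · rw [Set.inter_comm, hfin, measure_mono_top Set.inter_subset_right hfin]
  · exact measure_inter_conull (ae_mem_pastHitSet hneg hW hfin)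

end MeanReturnTime

end

end Horocycle

theorem mainTheorem9_general (Γ : Subgroup SL(2, ℝ)) [DiscreteTopology Γ]
    (hneg : (-1 : SL(2, ℝ)) ∈ Γ) (hcusp : Horocycle.HasWidthOneCuspAtInfinity Γ)
    (F : Set UpperHalfPlane)
    (hF : IsFundamentalDomain (Horocycle.moebiusGroup Γ) F (volume : Measure UpperHalfPlane)) :
    (∀ r s t : ℝ, 0 ≤ r → (ENNReal.ofReal r < Horocycle.backReturnTime Γ (s, t) ↔
      Horocycle.pointSet Γ (Horocycle.nMat s * Horocycle.aMat t) ∩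
        Horocycle.negTriangle r = ∅)) ∧
    Measurable (Horocycle.returnTime Γ) ∧
    Horocycle.meanReturnTime Γ =
      ENNReal.ofReal Real.pi * (volume : Measure UpperHalfPlane) F :=
  have := Horocycle.countable_of_discreteTopology Γ
  ⟨fun _ _ _ => Horocycle.lt_backReturnTime_iff hcusp.nMat_one_mem, Horocycle.measurable_returnTime,
    Horocycle.meanReturnTime_eq_pi_mul_volume hneg hcusp hF⟩

theorem mainTheorem9 (Γ : Subgroup SL(2, ℝ)) (hdisc : DiscreteTopology Γ)
    (hneg : (-1 : SL(2, ℝ)) ∈ Γ) (hcusp : Horocycle.HasWidthOneCuspAtInfinity Γ)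
    (F : Set UpperHalfPlane)
    (hF : IsFundamentalDomain (Horocycle.moebiusGroup Γ) F (volume : Measure UpperHalfPlane))
    (hfin : (volume : Measure UpperHalfPlane) F ≠ ⊤) :
    (∀ r s t : ℝ, 0 < r → (s, t) ∈ Horocycle.paramSpace →
      Horocycle.limitDensity Γ r (s, t) =
        1 / (Horocycle.meanReturnTime Γ).toReal *
          Horocycle.ind (Horocycle.pointSet Γ (Horocycle.nMat s * Horocycle.aMat t) ∩
            Horocycle.negTriangle r = ∅)) ∧
    Measurable (Horocycle.returnTime Γ) ∧
    Horocycle.meanReturnTime Γ =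
      ENNReal.ofReal Real.pi * (volume : Measure UpperHalfPlane) F := by
  obtain ⟨hiff, hrest⟩ := mainTheorem9_general Γ hneg hcusp F hF
  exact ⟨fun r s t hr _ => by rw [Horocycle.limitDensity, hiff r s t hr.le], hrest⟩
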